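/- Let $\mathbb T=\mathbb R/2\pi\mathbb Z$, identified with $[-\pi,\pi)$; functions on $\mathbb T$ are extended $2\pi$-periodically to $\mathbb R$. A weight is a measurable $2\pi$-periodic $\gamma:\mathbb R\to[0,\infty]$ that is positive a.e. For an arc $J$ of $\mathbb T$ (an interval of length $|J|\in(0,2\pi]$) write $\gamma(J)=\int_J\gamma$. The class $A\mathfrak S_p^1$ is defined as follows. * For $1<p<\infty$ it is the Muckenhoupt class $A_p$ of integrable weights with $$[\gamma]_p:=\sup_J \frac{\gamma(J)}{|J|}\Big(\frac1{|J|}\int_J\gamma(u)^{-1/(p-1)}\,du\Big)^{p-1}<\infty .$$ * For $p=1$ it is the class $\mathfrak S_1$ of weights with $[\gamma]_1:=\sup_J\gamma(J)/|J|<\infty$ and $\gamma\ge c$ a.e. for some $c>0$. * For $p=\infty$ it consists of $\gamma\equiv1$. Let $L_{p,\gamma}$ be the space of measurable $f:\mathbb T\to\mathbb R$ with finite norm $\|f\|_{p,\gamma}=(\int_{\mathbb T}|f|^p\gamma\,dx)^{1/p}$ for $p<\infty$, and $\|f\|_{\infty,\gamma}=\operatorname{ess\,sup}_{\mathbb T}|f|$.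 For $v>0$ let $\mathfrak T_vf(x)=\frac1v\int_x^{x+v}f(t)\,dt$ and, for $r\in\mathbb N=\{1,2,\dots\}$, $$\Omega_r(f,v)_{p,\gamma}=\|(\mathbb I-\mathfrak T_v)^rf\|_{p,\gamma}.$$ Let $\Pi_n$ be the set of real trigonometric polynomials of degree at most $n$ (constants included), and $E_n(f)_{p,\gamma}=\inf_{u\in\Pi_n}\|f-u\|_{p,\gamma}$. For $K\ge1$, a polynomial $U\in\Pi_n$ is called a near best approximant of $f$ with constant $K$ if $\|f-U\|_{p,\gamma}\le K\,E_n(f)_{p,\gamma}$ (for $K=1$: a best approximant). **Theorem (realization).** Let $r\in\mathbb N$, $1\le p\le\infty$, $K\ge1$, $M>0$ and $c>0$. There is a constant $C>0$, depending only on $r$, $p$, $K$, $M$ and, if $p=1$, on $c$, such that the following holds. Let $\gamma\in A\mathfrak S_p^1$, with $[\gamma]_p\le M$ if $1<p<\infty$, and with $[\gamma]_1\le M$ and $\gamma\ge c$ a.e. if $p=1$. Then for all $f\in L_{p,\gamma}$, all $n\in\mathbb N$ and every near best approximant $U\in\Pi_n$ of $f$ with constant $K$, $$C^{-1}\,\Omega_r(f,1/n)_{p,\gamma}\;\le\;\|f-U\|_{p,\gamma}+n^{-r}\|U^{(r)}\|_{p,\gamma}\;\le\;C\,\Omega_r(f,1/n)_{p,\gamma}.$$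 -/

import Mathlib

open MeasureTheory Set
open scoped ENNReal NNReal

noncomputable section

namespace WeightedTrig

/-- A (`2π`-periodic) weight: measurable, with values in `[0, ∞]`, and positive almost everywhere. -/
structure IsWeight (γ : ℝ → ℝ≥0∞) : Prop where
  aemeasurable : AEMeasurable γ volume
  periodic : Function.Periodic γ (2 * Real.pi)
  pos : ∀ᵐ x, 0 < γ x

/-- The average `(b - a)⁻¹ ∫_a^b g` of a nonnegative function, for `a < b`. -/
def avg (g : ℝ → ℝ≥0∞) (a b : ℝ) : ℝ≥0∞ :=
  (∫⁻ x in Icc a b, g x) / ENNReal.ofReal (b - a)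

/-- `sup_J γ(J) / mes(J)` over the arcs `J` of the circle, that is, over the intervals of length at
most `2π`, the weight being `2π`-periodic. -/
def meanConst (γ : ℝ → ℝ≥0∞) : ℝ≥0∞ :=
  ⨆ (a : ℝ) (b : ℝ) (_ : a < b) (_ : b ≤ a + 2 * Real.pi), avg γ a b

/-- The Muckenhoupt constant `sup_J (γ(J) / mes(J)) * (mes(J)⁻¹ ∫_J γ ^ (-1 / (p - 1))) ^ (p - 1)`
over the arcs `J` of the circle, for `1 < p < ∞`. -/
def muckenhouptConst (p : ℝ) (γ : ℝ → ℝ≥0∞) : ℝ≥0∞ :=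
  ⨆ (a : ℝ) (b : ℝ) (_ : a < b) (_ : b ≤ a + 2 * Real.pi),
    avg γ a b * avg (fun x => γ x ^ (-1 / (p - 1))) a b ^ (p - 1)

/-- The class `𝔖₁`: weights with bounded means that are bounded away from zero almost everywhere. -/
def MemS1 (γ : ℝ → ℝ≥0∞) : Prop :=
  IsWeight γ ∧ meanConst γ < ∞ ∧ ∃ c : ℝ≥0, 0 < c ∧ ∀ᵐ x, (c : ℝ≥0∞) ≤ γ x

/-- The Muckenhoupt class `A_p`, `1 < p < ∞`, of integrable `2π`-periodic weights. (The doubling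
property is a consequence.) -/
def MemA (p : ℝ) (γ : ℝ → ℝ≥0∞) : Prop :=
  IsWeight γ ∧ ∫⁻ x in Ioc (-Real.pi) Real.pi, γ x < ∞ ∧ muckenhouptConst p γ < ∞

/-- The class `A𝔖_p¹`: it is `𝔖₁` for `p = 1`, the Muckenhoupt class `A_p` for `1 < p < ∞`, and it
consists of `γ ≡ 1` for `p = ∞`. -/
def MemAS (p : ℝ≥0∞) (γ : ℝ → ℝ≥0∞) : Prop :=
  (p = 1 → MemS1 γ) ∧
  (1 < p → p < ∞ → MemA p.toReal γ) ∧
  (p = ∞ → IsWeight γ ∧ ∀ᵐ x, γ x = 1)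

/-- The constant `[γ]` of a weight of the class `A𝔖_p¹`: the bound of the means for `p = 1`, the
Muckenhoupt constant for `1 < p < ∞`, and `1` for `p = ∞` (where `γ ≡ 1`). -/
def weightConst (p : ℝ≥0∞) (γ : ℝ → ℝ≥0∞) : ℝ≥0∞ :=
  if p = 1 then meanConst γ else if p = ∞ then 1 else muckenhouptConst p.toReal γ

/-- The measure `γ(x) dx` on one period. -/
def wMeasure (γ : ℝ → ℝ≥0∞) : Measure ℝ :=
  (volume.restrict (Ioc (-Real.pi) Real.pi)).withDensity γ

/-- The norm `‖f‖_{p,γ}`. As a weight is positive almost everywhere, the case `p = ∞` is the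
essential supremum with respect to Lebesgue measure. -/
def wNorm (p : ℝ≥0∞) (γ : ℝ → ℝ≥0∞) (f : ℝ → ℝ) : ℝ≥0∞ :=
  eLpNorm f p (wMeasure γ)

/-- The weighted Lebesgue space `L_{p,γ}`; functions on the circle are `2π`-periodic functions on
the line. -/
def MemL (p : ℝ≥0∞) (γ : ℝ → ℝ≥0∞) (f : ℝ → ℝ) : Prop :=
  Function.Periodic f (2 * Real.pi) ∧ MemLp f p (wMeasure γ)

/-- The one-sided Steklov mean `v⁻¹ ∫_x^{x+v} f`. -/
def steklov (v : ℝ) (f : ℝ → ℝ) : ℝ → ℝ :=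
  fun x => v⁻¹ * ∫ t in x..(x + v), f t

/-- The operator `I - T_v`, where `T_v` is the one-sided Steklov mean. -/
def steklovDiff (v : ℝ) (f : ℝ → ℝ) : ℝ → ℝ :=
  fun x => f x - steklov v f x

/-- The modulus of smoothness `Ω_r(f, v)_{p,γ} = ‖(I - T_v)^r f‖_{p,γ}`, `v > 0`. -/
def Omega (r : ℕ) (f : ℝ → ℝ) (v : ℝ) (p : ℝ≥0∞) (γ : ℝ → ℝ≥0∞) : ℝ≥0∞ :=
  wNorm p γ ((steklovDiff v)^[r] f)

/-- The class `Π_n` of real trigonometric polynomials of degree at most `n`. -/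
def trigPoly (n : ℕ) : Set (ℝ → ℝ) :=
  {U | ∃ a b : ℕ → ℝ, ∀ x, U x =
    ∑ k ∈ Finset.range (n + 1), (a k * Real.cos (k * x) + b k * Real.sin (k * x))}

/-- The best approximation order `E_n(f)_{p,γ}`. -/
def bestApprox (n : ℕ) (f : ℝ → ℝ) (p : ℝ≥0∞) (γ : ℝ → ℝ≥0∞) : ℝ≥0∞ :=
  ⨅ u ∈ trigPoly n, wNorm p γ (fun x => f x - u x)

/-- `U ∈ Π_n` is a near best approximant of `f`, with constant `K`: `‖f - U‖ ≤ K * E_n(f)`. -/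
def IsNearBest (K : ℝ≥0) (n : ℕ) (f : ℝ → ℝ) (p : ℝ≥0∞) (γ : ℝ → ℝ≥0∞) (U : ℝ → ℝ) : Prop :=
  U ∈ trigPoly n ∧ wNorm p γ (fun x => f x - U x) ≤ K * bestApprox n f p γ

/-- The realization functional `‖f - U‖_{p,γ} + n^{-r} ‖U^{(r)}‖_{p,γ}`. -/
def realization (r n : ℕ) (f U : ℝ → ℝ) (p : ℝ≥0∞) (γ : ℝ → ℝ≥0∞) : ℝ≥0∞ :=
  wNorm p γ (fun x => f x - U x) + ((n : ℝ≥0∞) ^ r)⁻¹ * wNorm p γ (iteratedDeriv r U)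

end WeightedTrig

end

namespace WeightedTrig

/-! ### Integrals of nonnegative periodic functions -/

/-! Put v = 1/n. On Fourier coefficients I - T_v multiplies by 1 - b(kv), where b is the symbol of
`box`, and integration by parts gives 1 - b(y) = iy s(y), with s the symbol of `ramp`. As s has no
real zero (`symbol_ramp_ne_zero`), I - T_v behaves like v d/dx at frequencies up to n and is
invertible at high ones. The theorem then becomes a matter of bounding a few multiplier operators on
L_{p,γ}, uniformly in v and in the weight.

Boundedness (`exists_convBound`): a kernel with |R(t)| ≤ A/(1+t²) is dominated by a geometrically
weighted sum of means over dyadic intervals. For p < ∞ each mean is bounded because of `MeanIneq`,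
which is Hölder's inequality for A_p and immediate for 𝔖₁; for p = ∞ the L¹ norm of the kernel
suffices. A multiplier comes from such a kernel once it is C², Hermitian, and integrable with its
first two derivatives (`exists_kernel_of_integrable_deriv`).

Three facts follow. On polynomials, Ω_r(U, 1/n) and n^{-r}‖U^{(r)}‖ are equivalent
(`ConvBound.omega_trigRe_le`, `ConvBound.wNorm_iteratedDeriv_le`), the second bound using a kernel
that inverts s on [-1, 1]. Trivially Ω_r(f, v) ≤ C‖f‖ (`ConvBound.omega_le`). Finally E_n(f) ≤ C
Ω_r(f, 1/n) (`ConvBound.bestApprox_le`): with a low-frequency cutoff χ one has (1-χ)/(1-b) = 1 + b +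
w, where w has an admissible kernel, so f is recovered from (I - T_v)^r f up to a polynomial of
degree at most n. The theorem is the triangle inequality applied to f = (f - U) + U. -/

theorem lintegral_Ioc_periodic {G : ℝ → ℝ≥0∞} (hG : Function.Periodic G (2 * Real.pi)) (a b : ℝ) :
    ∫⁻ x in Ioc a (a + 2 * Real.pi), G x = ∫⁻ x in Ioc b (b + 2 * Real.pi), G x := by
  have : VAddInvariantMeasure (AddSubgroup.zmultiples (2 * Real.pi)) ℝ volume :=
    ⟨fun c s _ => measure_preimage_add _ _ _⟩
  exact IsAddFundamentalDomain.setLIntegral_eq (G := AddSubgroup.zmultiples (2 * Real.pi))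
    (isAddFundamentalDomain_Ioc Real.two_pi_pos a) (isAddFundamentalDomain_Ioc Real.two_pi_pos b)
    _ hG.map_vadd_zmultiples

theorem lintegral_Ioc_periodic_pi {G : ℝ → ℝ≥0∞} (hG : Function.Periodic G (2 * Real.pi)) (a : ℝ) :
    ∫⁻ x in Ioc a (a + 2 * Real.pi), G x = ∫⁻ x in Ioc (-Real.pi) Real.pi, G x := by
  rw [lintegral_Ioc_periodic hG a (-Real.pi)]
  congr 3; ring

theorem setLIntegral_comp_add (G : ℝ → ℝ≥0∞) (a b t : ℝ) :
    ∫⁻ x in Ioc a b, G (x + t) = ∫⁻ x in Ioc (a + t) (b + t), G x := by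
  have h := (measurePreserving_add_right volume t).setLIntegral_comp_preimage_emb
    (measurableEmbedding_addRight t) G (Ioc (a + t) (b + t))
  rw [← h]
  congr 2
  ext x; simp

theorem setLIntegral_comp_add_left (G : ℝ → ℝ≥0∞) (a b t : ℝ) :
    ∫⁻ x in Ioc a b, G (t + x) = ∫⁻ x in Ioc (t + a) (t + b), G x := by
  simp_rw [add_comm t]
  exact setLIntegral_comp_add G a b t

theorem lintegral_period_comp_add {G : ℝ → ℝ≥0∞} (hG : Function.Periodic G (2 * Real.pi)) (t : ℝ) :
    ∫⁻ x in Ioc (-Real.pi) Real.pi, G (x + t) = ∫⁻ x in Ioc (-Real.pi) Real.pi, G x := by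
  rw [setLIntegral_comp_add, ← lintegral_Ioc_periodic_pi hG (-Real.pi + t)]
  congr 3; ring

theorem lintegral_Ioc_nat_periods {G : ℝ → ℝ≥0∞} (hG : Function.Periodic G (2 * Real.pi))
    (a : ℝ) (N : ℕ) :
    ∫⁻ x in Ioc a (a + N * (2 * Real.pi)), G x = N * ∫⁻ x in Ioc (-Real.pi) Real.pi, G x := by
  induction N with
  | zero => simp
  | succ N ih =>
    have hpi := Real.two_pi_pos
    have h1 : a ≤ a + N * (2 * Real.pi) := by
      have : (0 : ℝ) ≤ N * (2 * Real.pi) := by positivity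
      linarith
    have h2 : a + N * (2 * Real.pi) ≤ a + (N + 1 : ℕ) * (2 * Real.pi) := by
      push_cast; linarith
    rw [← Ioc_union_Ioc_eq_Ioc h1 h2, lintegral_union measurableSet_Ioc
      (Ioc_disjoint_Ioc_of_le le_rfl), ih]
    have h3 : a + (N + 1 : ℕ) * (2 * Real.pi) = a + N * (2 * Real.pi) + 2 * Real.pi := by
      push_cast; ring
    rw [h3, lintegral_Ioc_periodic_pi hG]
    push_cast; ring

theorem quasiMeasurePreserving_add_mul (v : ℝ) :
    Measure.QuasiMeasurePreserving (fun z : ℝ × ℝ => z.1 + v * z.2)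
      ((volume : Measure ℝ).prod volume) volume :=
  QuasiMeasurePreserving.prod_of_left (by fun_prop) (Filter.Eventually.of_forall fun t =>
    (measurePreserving_add_right volume (v * t)).quasiMeasurePreserving)

/-- Fubini and translation invariance: each point of the circle is covered with total mass b - a.
This turns estimates on short arcs into estimates on the whole circle. -/
theorem lintegral_period_lintegral_Ioc {G : ℝ → ℝ≥0∞} (hG : Function.Periodic G (2 * Real.pi))
    (hm : AEMeasurable G) (a b : ℝ) :
    ∫⁻ y in Ioc (-Real.pi) Real.pi, ∫⁻ u in Ioc (y + a) (y + b), G u =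
      ENNReal.ofReal (b - a) * ∫⁻ x in Ioc (-Real.pi) Real.pi, G x := by
  simp_rw [← setLIntegral_comp_add_left G a b]
  rw [lintegral_lintegral_swap]
  · simp_rw [lintegral_period_comp_add hG]
    simp [mul_comm]
  · have h := hm.comp_quasiMeasurePreserving (quasiMeasurePreserving_add_mul 1)
    simp only [Function.comp_def, one_mul] at h
    refine AEMeasurable.mono_measure (μ := (volume : Measure ℝ).prod volume) h ?_
    rw [Measure.prod_restrict]
    exact Measure.restrict_le_self

/-- The mean of a nonnegative function over `(x - s, x + s]`. -/
noncomputable def symMean (s : ℝ) (F : ℝ → ℝ≥0∞) (x : ℝ) : ℝ≥0∞ :=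
  (∫⁻ u in Ioc (x - s) (x + s), F u) / ENNReal.ofReal (2 * s)

theorem measurable_symMean {F : ℝ → ℝ≥0∞} (hF : AEMeasurable F) (s : ℝ) :
    Measurable (symMean s F) := by
  obtain ⟨F', hF', he⟩ := hF
  have : symMean s F = fun x => (∫⁻ t in Ioc (-s) s, F' (x + t)) / ENNReal.ofReal (2 * s) := by
    funext x
    rw [symMean, setLIntegral_comp_add_left, ← sub_eq_add_neg]
    congr 1
    exact lintegral_congr_ae (ae_restrict_of_ae he)
  rw [this]
  refine Measurable.div_const ?_ _
  exact Measurable.lintegral_prod_right' (f := fun z : ℝ × ℝ => F' (z.1 + z.2))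
    (hF'.comp (by fun_prop))

theorem symMean_periodic {F : ℝ → ℝ≥0∞} (hF : Function.Periodic F (2 * Real.pi)) (s : ℝ) :
    Function.Periodic (symMean s F) (2 * Real.pi) := by
  intro x
  have h (y : ℝ) : ∫⁻ u in Ioc (y - s) (y + s), F u = ∫⁻ t in Ioc (-s) s, F (y + t) := by
    rw [setLIntegral_comp_add_left, ← sub_eq_add_neg]
  simp only [symMean, h]
  congr 2
  funext t
  rw [show x + 2 * Real.pi + t = x + t + 2 * Real.pi by ring, hF]

/-- The mean inequality `γ(I) (|I|⁻¹ ∫_I F) ^ p ≤ D ∫_I F ^ p γ` on all arcs. -/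
def MeanIneq (D : ℝ≥0) (p : ℝ) (γ : ℝ → ℝ≥0∞) : Prop :=
  ∀ a b : ℝ, a < b → b ≤ a + 2 * Real.pi → ∀ F : ℝ → ℝ≥0∞, AEMeasurable F →
    (∫⁻ x in Ioc a b, γ x) * ((∫⁻ x in Ioc a b, F x) / ENNReal.ofReal (b - a)) ^ p ≤
      D * ∫⁻ x in Ioc a b, F x ^ p * γ x

/-- For x in (y, y+s] the interval of the mean lies in (y-s, y+2s], so all these means are at most
three times one mean over an arc of length 3s ≤ 2π, where `MeanIneq` applies. The local bounds are
then averaged over y. -/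
theorem lintegral_symMean_rpow_le_of_le {D : ℝ≥0} {p : ℝ} {γ F : ℝ → ℝ≥0∞} (hp : 1 ≤ p)
    (hD : MeanIneq D p γ) (hγm : AEMeasurable γ) (hγ : Function.Periodic γ (2 * Real.pi))
    (hFm : AEMeasurable F) (hF : Function.Periodic F (2 * Real.pi)) {s : ℝ} (hs : 0 < s)
    (hs' : 3 * s ≤ 2 * Real.pi) :
    ∫⁻ x in Ioc (-Real.pi) Real.pi, symMean s F x ^ p * γ x ≤
      3 * 3 ^ p * D * ∫⁻ x in Ioc (-Real.pi) Real.pi, F x ^ p * γ x := by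
  have hp0 : 0 ≤ p := by linarith
  have hG1 : Function.Periodic (fun x => symMean s F x ^ p * γ x) (2 * Real.pi) := fun x => by
    simp only [symMean_periodic hF s x, hγ x]
  have hG2 : Function.Periodic (fun x => F x ^ p * γ x) (2 * Real.pi) := fun x => by
    simp only [hF x, hγ x]
  have key (y : ℝ) : ∫⁻ x in Ioc (y + 0) (y + s), symMean s F x ^ p * γ x ≤
      3 ^ p * D * ∫⁻ x in Ioc (y + -s) (y + 2 * s), F x ^ p * γ x := by
    have hlen : (y + 2 * s) - (y + -s) = 3 * s := by ring
    set B := (∫⁻ x in Ioc (y + -s) (y + 2 * s), F x) / ENNReal.ofReal ((y + 2 * s) - (y + -s))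
      with hB
    have hsub : ∀ x ∈ Ioc (y + 0) (y + s), symMean s F x ≤ 3 * B := by
      intro x hx
      have h1 : ∫⁻ u in Ioc (x - s) (x + s), F u ≤ ∫⁻ x in Ioc (y + -s) (y + 2 * s), F x := by
        apply lintegral_mono_set
        apply Ioc_subset_Ioc <;> linarith [hx.1, hx.2]
      have h3 : (3 : ℝ≥0∞) = ENNReal.ofReal 3 := by simp
      rw [symMean, hB, hlen, ENNReal.ofReal_mul (p := 3) (by norm_num), ← h3, ← mul_div_assoc,
        ENNReal.mul_div_mul_left _ _ (by simp) (by simp)]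
      refine (ENNReal.div_le_div_right h1 _).trans (ENNReal.div_le_div_left ?_ _)
      exact ENNReal.ofReal_le_ofReal (by linarith)
    calc ∫⁻ x in Ioc (y + 0) (y + s), symMean s F x ^ p * γ x
        ≤ ∫⁻ x in Ioc (y + 0) (y + s), (3 * B) ^ p * γ x := by
          refine setLIntegral_mono_ae (by fun_prop) (Filter.Eventually.of_forall fun x hx => ?_)
          gcongr
          exact hsub x hx
      _ ≤ ∫⁻ x in Ioc (y + -s) (y + 2 * s), (3 * B) ^ p * γ x := by
          apply lintegral_mono_set
          exact Ioc_subset_Ioc (by linarith) (by linarith)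
      _ = 3 ^ p * ((∫⁻ x in Ioc (y + -s) (y + 2 * s), γ x) * B ^ p) := by
          rw [lintegral_const_mul'' _ (hγm.restrict), ENNReal.mul_rpow_of_nonneg _ _ hp0]
          ring
      _ ≤ 3 ^ p * (D * ∫⁻ x in Ioc (y + -s) (y + 2 * s), F x ^ p * γ x) := by
          refine mul_le_mul_right ?_ _
          exact hD _ _ (by linarith) (by linarith) F hFm
      _ = _ := by ring
  have hs0 : ENNReal.ofReal s ≠ 0 := by simpa using hs
  have hfin : 3 ^ p * D * (3 * ∫⁻ x in Ioc (-Real.pi) Real.pi, F x ^ p * γ x) =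
    3 * 3 ^ p * D * ∫⁻ x in Ioc (-Real.pi) Real.pi, F x ^ p * γ x := by ring
  -- Averaging over y produces the factor s on the left and 3s on the right; their ratio is the
  -- extra 3 in the constant.
  rw [← hfin, ← ENNReal.mul_le_mul_iff_right hs0 ENNReal.ofReal_ne_top]
  calc ENNReal.ofReal s * ∫⁻ x in Ioc (-Real.pi) Real.pi, symMean s F x ^ p * γ x
      = ∫⁻ y in Ioc (-Real.pi) Real.pi, ∫⁻ x in Ioc (y + 0) (y + s), symMean s F x ^ p * γ x := by
        rw [lintegral_period_lintegral_Ioc hG1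
          (((measurable_symMean hFm s).pow_const p).aemeasurable.mul hγm), sub_zero]
    _ ≤ ∫⁻ y in Ioc (-Real.pi) Real.pi,
          3 ^ p * D * ∫⁻ x in Ioc (y + -s) (y + 2 * s), F x ^ p * γ x := lintegral_mono key
    _ ≤ 3 ^ p * D * ∫⁻ y in Ioc (-Real.pi) Real.pi,
          ∫⁻ x in Ioc (y + -s) (y + 2 * s), F x ^ p * γ x := by
        refine (lintegral_const_mul' _ _ ?_).le
        exact ENNReal.mul_ne_top (ENNReal.rpow_ne_top_of_nonneg hp0 (by simp)) (by simp)
    _ = 3 ^ p * D * (ENNReal.ofReal (3 * s) *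
          ∫⁻ x in Ioc (-Real.pi) Real.pi, F x ^ p * γ x) := by
        rw [lintegral_period_lintegral_Ioc hG2 ((hFm.pow_const p).mul hγm)]
        congr 3; ring
    _ = _ := by
        rw [ENNReal.ofReal_mul (by norm_num)]
        simp only [ENNReal.ofReal_ofNat]
        ring

/-- A long interval is covered by whole periods, so its mean is comparable to the mean over one
period, and `MeanIneq` is needed on the full circle only. -/
theorem lintegral_symMean_rpow_le_of_ge {D : ℝ≥0} {p : ℝ} {γ F : ℝ → ℝ≥0∞} (hp : 1 ≤ p)
    (hD : MeanIneq D p γ) (hγm : AEMeasurable γ)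
    (hFm : AEMeasurable F) (hF : Function.Periodic F (2 * Real.pi)) {s : ℝ}
    (hs' : 2 * Real.pi ≤ 3 * s) :
    ∫⁻ x in Ioc (-Real.pi) Real.pi, symMean s F x ^ p * γ x ≤
      3 ^ p * D * ∫⁻ x in Ioc (-Real.pi) Real.pi, F x ^ p * γ x := by
  have hp0 : 0 ≤ p := by linarith
  have hpi := Real.pi_pos
  have hs : 0 < s := by linarith
  set B := (∫⁻ x in Ioc (-Real.pi) Real.pi, F x) / ENNReal.ofReal (Real.pi - (-Real.pi)) with hB
  have hle (x : ℝ) : symMean s F x ≤ 3 * B := by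
    -- N periods cover an interval of length 2s, and N ≤ s/π + 1 ≤ 3s/π because s ≥ 2π/3.
    obtain ⟨N, hN1, hN2⟩ : ∃ N : ℕ, s / Real.pi ≤ N ∧ (N : ℝ) ≤ s / Real.pi + 1 :=
      ⟨⌈s / Real.pi⌉₊, Nat.le_ceil _, (Nat.ceil_lt_add_one (by positivity)).le⟩
    rw [div_le_iff₀ hpi] at hN1
    have hN3 : N * Real.pi ≤ s + Real.pi := by
      have := mul_le_mul_of_nonneg_right hN2 hpi.le
      rwa [add_mul, div_mul_cancel₀ _ hpi.ne', one_mul] at this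
    have h1 : ∫⁻ u in Ioc (x - s) (x + s), F u ≤
        N * ∫⁻ x in Ioc (-Real.pi) Real.pi, F x := by
      rw [← lintegral_Ioc_nat_periods hF (x - s)]
      apply lintegral_mono_set
      apply Ioc_subset_Ioc <;> nlinarith
    have h3 : (3 : ℝ≥0∞) = ENNReal.ofReal 3 := by simp
    have h4 : ENNReal.ofReal (2 * s) = ENNReal.ofReal (s / Real.pi) *
        ENNReal.ofReal (Real.pi - (-Real.pi)) := by
      rw [← ENNReal.ofReal_mul (by positivity)]
      congr 1; field_simp; ring
    have h5 : (N : ℝ≥0∞) ≤ 3 * ENNReal.ofReal (s / Real.pi) := by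
      rw [h3, ← ENNReal.ofReal_mul (by norm_num), ← ENNReal.ofReal_natCast]
      apply ENNReal.ofReal_le_ofReal
      rw [← mul_div_assoc, le_div_iff₀ hpi]
      linarith
    have hne : ENNReal.ofReal (s / Real.pi) ≠ 0 := by
      have : 0 < s / Real.pi := by positivity
      simpa using this
    calc symMean s F x ≤ 3 * ENNReal.ofReal (s / Real.pi) *
          (∫⁻ x in Ioc (-Real.pi) Real.pi, F x) / ENNReal.ofReal (2 * s) := by
            refine ENNReal.div_le_div_right (h1.trans ?_) _
            gcongr
      _ = 3 * B := by
        rw [h4, hB, mul_comm 3, mul_assoc, ENNReal.mul_div_mul_left _ _ hne ENNReal.ofReal_ne_top,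
          mul_div_assoc]
  calc ∫⁻ x in Ioc (-Real.pi) Real.pi, symMean s F x ^ p * γ x
      ≤ ∫⁻ x in Ioc (-Real.pi) Real.pi, (3 * B) ^ p * γ x := by
        refine lintegral_mono fun x => ?_
        gcongr
        exact hle x
    _ = 3 ^ p * ((∫⁻ x in Ioc (-Real.pi) Real.pi, γ x) * B ^ p) := by
        rw [lintegral_const_mul'' _ (hγm.restrict), ENNReal.mul_rpow_of_nonneg _ _ hp0]
        ring
    _ ≤ 3 ^ p * (D * ∫⁻ x in Ioc (-Real.pi) Real.pi, F x ^ p * γ x) := by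
        refine mul_le_mul_right ?_ _
        exact hD _ _ (by linarith) (le_of_eq (by ring)) F hFm
    _ = _ := by ring

theorem lintegral_symMean_rpow_le {D : ℝ≥0} {p : ℝ} {γ F : ℝ → ℝ≥0∞} (hp : 1 ≤ p)
    (hD : MeanIneq D p γ) (hγm : AEMeasurable γ) (hγ : Function.Periodic γ (2 * Real.pi))
    (hFm : AEMeasurable F) (hF : Function.Periodic F (2 * Real.pi)) {s : ℝ} (hs : 0 < s) :
    ∫⁻ x in Ioc (-Real.pi) Real.pi, symMean s F x ^ p * γ x ≤
      3 * 3 ^ p * D * ∫⁻ x in Ioc (-Real.pi) Real.pi, F x ^ p * γ x := by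
  rcases le_total (3 * s) (2 * Real.pi) with h | h
  · exact lintegral_symMean_rpow_le_of_le hp hD hγm hγ hFm hF hs h
  · refine (lintegral_symMean_rpow_le_of_ge hp hD hγm hFm hF h).trans ?_
    gcongr
    nth_rewrite 1 [← one_mul ((3 : ℝ≥0∞) ^ p)]
    gcongr
    norm_num

/-! ### Kernels with an integrable majorant -/

theorem setLIntegral_comp_add_mul (F : ℝ → ℝ≥0∞) {v : ℝ} (hv : 0 < v) (a b x : ℝ) :
    ∫⁻ t in Ioc a b, F (x + v * t) =
      ENNReal.ofReal v⁻¹ * ∫⁻ u in Ioc (x + v * a) (x + v * b), F u := by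
  rw [← setLIntegral_comp_add_left F]
  have hemb : MeasurableEmbedding (fun t : ℝ => v * t) := measurableEmbedding_mulLeft₀ hv.ne'
  have h : ∫⁻ t in Ioc (v * a) (v * b), F (x + t) ∂(Measure.map (fun t : ℝ => v * t) volume) =
      ∫⁻ t in (fun t : ℝ => v * t) ⁻¹' Ioc (v * a) (v * b), F (x + v * t) := by
    rw [hemb.restrict_map, hemb.lintegral_map]
  rw [Real.map_volume_mul_left hv.ne', abs_of_pos (inv_pos.2 hv), Measure.restrict_smul,
    lintegral_smul_measure, smul_eq_mul] at h
  rw [h]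
  congr 2
  ext t
  simp [hv, mul_div_cancel_left₀ _ hv.ne']

/-- The majorant `∫ (1 + t ^ 2)⁻¹ F (x + v t) dt`. -/
noncomputable def poissonMajorant (v : ℝ) (F : ℝ → ℝ≥0∞) (x : ℝ) : ℝ≥0∞ :=
  ∫⁻ t, ENNReal.ofReal (1 / (1 + t ^ 2)) * F (x + v * t)

theorem exists_dyadic_bound (t : ℝ) : ∃ j : ℕ, t ∈ Ioc (-(2 : ℝ) ^ j) (2 ^ j) ∧
    1 / (1 + t ^ 2) ≤ 4 * (4 ^ j)⁻¹ := by
  rcases lt_or_ge |t| 1 with h | h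
  · refine ⟨0, ?_, ?_⟩
    · rw [abs_lt] at h
      simp only [pow_zero, mem_Ioc]
      exact ⟨h.1, h.2.le⟩
    · rw [div_le_iff₀ (by positivity)]
      simp only [pow_zero, inv_one]
      nlinarith [sq_nonneg t]
  · obtain ⟨j, h1, h2⟩ := exists_nat_pow_near h (one_lt_two)
    refine ⟨j + 1, ?_, ?_⟩
    · rw [abs_lt] at h2
      exact ⟨h2.1, h2.2.le⟩
    · have h3 : (4 : ℝ) ^ j ≤ t ^ 2 := by
        rw [show (4 : ℝ) = 2 ^ 2 by norm_num, ← pow_mul, mul_comm, pow_mul, ← sq_abs t]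
        gcongr
      rw [pow_succ (4 : ℝ), mul_inv, mul_comm _ (4 : ℝ)⁻¹, ← mul_assoc,
        mul_inv_cancel₀ (by norm_num),
        one_mul, one_div]
      apply inv_anti₀ (by positivity)
      linarith

/-- On (-2^j, 2^j] the dyadic bound 4·4^{-j} times the length 2·2^j leaves 8·2^{-j} = 16·2^{-(j+1)}.
The 16 is pulled out so that the remaining weights sum to 1. -/
theorem poissonMajorant_le_tsum {F : ℝ → ℝ≥0∞} (hF : AEMeasurable F) {v : ℝ} (hv : 0 < v)
    (x : ℝ) : poissonMajorant v F x ≤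
      16 * ∑' j : ℕ, ((2 : ℝ≥0∞)⁻¹ ^ (j + 1)) * symMean (2 ^ j * v) F x := by
  have hm : AEMeasurable (fun t => F (x + v * t)) :=
    hF.comp_quasiMeasurePreserving ⟨by fun_prop, by
      have : (fun t : ℝ => x + v * t) = (fun t => x + t) ∘ (fun t => v * t) := rfl
      rw [this, ← Measure.map_map (by fun_prop) (by fun_prop), Real.map_volume_mul_left hv.ne',
        Measure.map_smul, (measurePreserving_add_left volume x).map_eq]
      exact Measure.smul_absolutelyContinuous⟩
  have h1 (t : ℝ) : ENNReal.ofReal (1 / (1 + t ^ 2)) * F (x + v * t) ≤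
      ∑' j : ℕ, (Ioc (-(2 : ℝ) ^ j) (2 ^ j)).indicator
        (fun t => (4 * ((4 : ℝ≥0∞) ^ j)⁻¹) * F (x + v * t)) t := by
    obtain ⟨j, hj, hb⟩ := exists_dyadic_bound t
    refine le_trans ?_ (ENNReal.le_tsum j)
    rw [indicator_of_mem hj]
    gcongr
    refine (ENNReal.ofReal_le_ofReal hb).trans (le_of_eq ?_)
    rw [ENNReal.ofReal_mul (by norm_num), ENNReal.ofReal_inv_of_pos (by positivity),
      ENNReal.ofReal_pow (by norm_num)]
    simp
  calc poissonMajorant v F x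
      ≤ ∫⁻ t, ∑' j : ℕ, (Ioc (-(2 : ℝ) ^ j) (2 ^ j)).indicator
        (fun t => (4 * ((4 : ℝ≥0∞) ^ j)⁻¹) * F (x + v * t)) t := lintegral_mono h1
    _ = ∑' j : ℕ, ∫⁻ t, (Ioc (-(2 : ℝ) ^ j) (2 ^ j)).indicator
        (fun t => (4 * ((4 : ℝ≥0∞) ^ j)⁻¹) * F (x + v * t)) t :=
        lintegral_tsum fun j => (hm.const_mul _).indicator measurableSet_Ioc
    _ = 16 * ∑' j : ℕ, ((2 : ℝ≥0∞)⁻¹ ^ (j + 1)) * symMean (2 ^ j * v) F x := by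
        rw [← ENNReal.tsum_mul_left]
        congr 1
        funext j
        rw [lintegral_indicator measurableSet_Ioc, lintegral_const_mul' _ _
          (ENNReal.mul_ne_top (by simp) (by simp)), setLIntegral_comp_add_mul F hv, symMean]
        have e1 : x + v * -2 ^ j = x - 2 ^ j * v := by ring
        have e2 : x + v * 2 ^ j = x + 2 ^ j * v := by ring
        rw [e1, e2, ENNReal.div_eq_inv_mul]
        have e3 : (ENNReal.ofReal (2 * (2 ^ j * v)))⁻¹ =
            (2⁻¹ : ℝ≥0∞) ^ (j + 1) * ENNReal.ofReal v⁻¹ := by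
          rw [← ENNReal.ofReal_inv_of_pos (by positivity), ← mul_assoc, mul_inv,
            ENNReal.ofReal_mul (by positivity), ← pow_succ', ENNReal.ofReal_inv_of_pos
            (by positivity), ENNReal.ofReal_pow (by norm_num), ENNReal.inv_pow]
          simp
        have e4 : (4 : ℝ≥0∞) * (4 ^ j)⁻¹ = 16 * (2⁻¹ ^ (j + 1) * 2⁻¹ ^ (j + 1)) := by
          rw [← mul_pow, pow_succ, ENNReal.inv_pow, ← ENNReal.mul_inv (by simp) (by simp)]
          have : (2 : ℝ≥0∞) * 2 = 4 := by norm_num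
          rw [this, mul_comm ((4 : ℝ≥0∞)⁻¹ ^ j), ← mul_assoc]
          congr 1
          have : (16 : ℝ≥0∞) = 4 * 4 := by norm_num
          rw [this, mul_assoc, ENNReal.mul_inv_cancel (by simp) (by simp), mul_one]
        rw [e3, e4]
        ring

theorem tsum_geometric_two_inv_succ : ∑' j : ℕ, (2 : ℝ≥0∞)⁻¹ ^ (j + 1) = 1 := by
  simp_rw [pow_succ]
  rw [ENNReal.tsum_mul_right, ENNReal.tsum_geometric, ENNReal.one_sub_inv_two, inv_inv,
    ENNReal.mul_inv_cancel (by simp) (by simp)]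

/-- Jensen's inequality for the probability measure on ℕ with masses w, obtained from the
monotonicity of L^p norms in p. -/
theorem tsum_mul_rpow_le {w a : ℕ → ℝ≥0∞} (hw : ∑' j, w j = 1) {p : ℝ} (hp : 1 ≤ p) :
    (∑' j, w j * a j) ^ p ≤ ∑' j, w j * a j ^ p := by
  set μ : Measure ℕ := Measure.count.withDensity w
  have hint (b : ℕ → ℝ≥0∞) : ∫⁻ j, b j ∂μ = ∑' j, w j * b j := by
    rw [lintegral_withDensity_eq_lintegral_mul _ (measurable_of_countable _)
      (measurable_of_countable _), lintegral_count]
    rfl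
  have huniv : μ univ = 1 := by
    have := hint 1
    simpa [hw] using this
  have h := eLpNorm'_le_eLpNorm'_mul_rpow_measure_univ (μ := μ) (f := a) one_pos hp
    (measurable_of_countable _).aestronglyMeasurable
  simp only [eLpNorm', huniv, ENNReal.one_rpow, mul_one, ENNReal.rpow_one, enorm_eq_self,
    hint, one_div, inv_one] at h
  calc (∑' j, w j * a j) ^ p ≤ ((∑' j, w j * a j ^ p) ^ p⁻¹) ^ p := by gcongr
    _ = _ := by rw [← ENNReal.rpow_mul, inv_mul_cancel₀ (by linarith), ENNReal.rpow_one]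

theorem lintegral_poissonMajorant_rpow_le {D : ℝ≥0} {p : ℝ} {γ F : ℝ → ℝ≥0∞} (hp : 1 ≤ p)
    (hD : MeanIneq D p γ) (hγm : AEMeasurable γ) (hγ : Function.Periodic γ (2 * Real.pi))
    (hFm : AEMeasurable F) (hF : Function.Periodic F (2 * Real.pi)) {v : ℝ} (hv : 0 < v) :
    ∫⁻ x in Ioc (-Real.pi) Real.pi, poissonMajorant v F x ^ p * γ x ≤
      16 ^ p * (3 * 3 ^ p * D) * ∫⁻ x in Ioc (-Real.pi) Real.pi, F x ^ p * γ x := by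
  have hp0 : 0 ≤ p := by linarith
  set I := ∫⁻ x in Ioc (-Real.pi) Real.pi, F x ^ p * γ x
  have h16 : (16 : ℝ≥0∞) ^ p ≠ ∞ := ENNReal.rpow_ne_top_of_nonneg hp0 (by simp)
  calc ∫⁻ x in Ioc (-Real.pi) Real.pi, poissonMajorant v F x ^ p * γ x
      ≤ ∫⁻ x in Ioc (-Real.pi) Real.pi, 16 ^ p *
          ∑' j : ℕ, (2 : ℝ≥0∞)⁻¹ ^ (j + 1) * (symMean (2 ^ j * v) F x ^ p * γ x) := by
        refine lintegral_mono fun x => ?_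
        have := tsum_mul_rpow_le (a := fun j => symMean (2 ^ j * v) F x)
          tsum_geometric_two_inv_succ hp
        calc poissonMajorant v F x ^ p * γ x
            ≤ (16 * ∑' j : ℕ, (2 : ℝ≥0∞)⁻¹ ^ (j + 1) * symMean (2 ^ j * v) F x) ^ p * γ x := by
              gcongr
              exact poissonMajorant_le_tsum hFm hv x
          _ ≤ 16 ^ p * (∑' j : ℕ, (2 : ℝ≥0∞)⁻¹ ^ (j + 1) * symMean (2 ^ j * v) F x ^ p) * γ x := by
              rw [ENNReal.mul_rpow_of_nonneg _ _ hp0]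
              gcongr
          _ = _ := by
              rw [mul_assoc, ← ENNReal.tsum_mul_right]
              simp_rw [mul_assoc]
    _ = 16 ^ p * ∑' j : ℕ, (2 : ℝ≥0∞)⁻¹ ^ (j + 1) *
          ∫⁻ x in Ioc (-Real.pi) Real.pi, symMean (2 ^ j * v) F x ^ p * γ x := by
        rw [lintegral_const_mul' _ _ h16, lintegral_tsum]
        · congr 2
          funext j
          exact lintegral_const_mul' _ _ (by simp)
        · intro j
          exact ((((measurable_symMean hFm _).pow_const p).aemeasurable.mul
            hγm.restrict).const_mul _)
    _ ≤ 16 ^ p * ∑' j : ℕ, (2 : ℝ≥0∞)⁻¹ ^ (j + 1) * (3 * 3 ^ p * D * I) := by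
        gcongr with j
        exact lintegral_symMean_rpow_le hp hD hγm hγ hFm hF (by positivity)
    _ = _ := by
        rw [ENNReal.tsum_mul_right, tsum_geometric_two_inv_succ]
        ring

/-! ### The mean inequality for the weight classes -/

/-- Almost everywhere F ≤ Fγ/c, and the mean of γ over the arc is at most M. -/
theorem meanIneq_one {γ : ℝ → ℝ≥0∞} {M c : ℝ≥0} (hc : 0 < c) (hM : meanConst γ ≤ M)
    (hγc : ∀ᵐ x, (c : ℝ≥0∞) ≤ γ x) : MeanIneq (M / c) 1 γ := by
  intro a b hab hb F hF
  have h0 : (c : ℝ≥0∞) ≠ 0 := by exact_mod_cast hc.ne'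
  have h1 : avg γ a b ≤ M := by
    refine le_trans ?_ hM
    exact le_iSup_of_le a (le_iSup_of_le b (le_iSup_of_le hab (le_iSup_of_le hb le_rfl)))
  rw [avg, ← setLIntegral_congr Ioc_ae_eq_Icc] at h1
  have h2 : c * ∫⁻ x in Ioc a b, F x ≤ ∫⁻ x in Ioc a b, F x * γ x := by
    rw [← lintegral_const_mul' _ _ (by simp)]
    refine lintegral_mono_ae ?_
    filter_upwards [ae_restrict_of_ae hγc] with x hx
    rw [mul_comm]
    gcongr
  simp only [ENNReal.rpow_one]
  calc (∫⁻ x in Ioc a b, γ x) * ((∫⁻ x in Ioc a b, F x) / ENNReal.ofReal (b - a))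
      = (∫⁻ x in Ioc a b, γ x) / ENNReal.ofReal (b - a) *
          ((c : ℝ≥0∞)⁻¹ * (c * ∫⁻ x in Ioc a b, F x)) := by
        rw [← mul_assoc (c : ℝ≥0∞)⁻¹, ENNReal.inv_mul_cancel h0 (by simp), one_mul,
          ENNReal.mul_comm_div]
    _ ≤ M * ((c : ℝ≥0∞)⁻¹ * ∫⁻ x in Ioc a b, F x * γ x) := by gcongr
    _ = _ := by
        rw [ENNReal.coe_div hc.ne', ENNReal.div_eq_inv_mul]
        ring

/-- Hölder's inequality for F = (Fγ^{1/p})·γ^{-1/p}: the dual factor is a power of ∫γ^{-1/(p-1)},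
and raising to the power p reproduces the Muckenhoupt product. -/
theorem meanIneq_of_muckenhoupt {p : ℝ} (hp : 1 < p) {γ : ℝ → ℝ≥0∞} (hγ : MemA p γ) {M : ℝ≥0}
    (hM : muckenhouptConst p γ ≤ M) : MeanIneq M p γ := by
  intro a b hab hb F hF
  have hp0 : 0 < p := by linarith
  obtain ⟨⟨hm, hper, hpos⟩, hint, -⟩ := hγ
  set q := p / (p - 1) with hq
  have hpq : p.HolderConjugate q := Real.HolderConjugate.conjExponent hp
  have hab' : Ioc a b ⊆ Ioc a (a + 2 * Real.pi) := Ioc_subset_Ioc le_rfl hb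
  -- The factorization needs γ^{1/p}γ^{-1/p} = 1, which requires γ finite as well as positive;
  -- finiteness comes from integrability over a period.
  have hfin : ∀ᵐ x ∂(volume.restrict (Ioc a b)), γ x < ∞ := by
    refine ae_lt_top' hm.restrict (ne_of_lt (lt_of_le_of_lt (lintegral_mono_set hab') ?_))
    rwa [lintegral_Ioc_periodic_pi hper]
  have h1 : avg γ a b * avg (fun x => γ x ^ (-1 / (p - 1))) a b ^ (p - 1) ≤ M := by
    refine le_trans ?_ hM
    exact le_iSup_of_le a (le_iSup_of_le b (le_iSup_of_le hab (le_iSup_of_le hb le_rfl)))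
  rw [avg, avg, ← setLIntegral_congr Ioc_ae_eq_Icc, ← setLIntegral_congr Ioc_ae_eq_Icc] at h1
  set σ := ∫⁻ x in Ioc a b, γ x ^ (-1 / (p - 1)) with hσ
  set J := ∫⁻ x in Ioc a b, F x ^ p * γ x with hJ
  set ℓ := ENNReal.ofReal (b - a) with hℓ
  have hℓ0 : ℓ ≠ 0 := by simpa [hℓ] using hab
  have hℓt : ℓ ≠ ∞ := ENNReal.ofReal_ne_top
  have h2 : (∫⁻ x in Ioc a b, F x) ≤ J ^ (1 / p) * σ ^ (1 / q) := by
    have h := ENNReal.lintegral_mul_le_Lp_mul_Lq (volume.restrict (Ioc a b)) hpq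
      (f := fun x => F x * γ x ^ (1 / p)) (g := fun x => γ x ^ (-(1 / p)))
      (hF.mul (hm.pow_const _)).restrict (hm.pow_const _).restrict
    refine le_trans (le_of_eq ?_) (h.trans (le_of_eq ?_))
    · refine lintegral_congr_ae ?_
      filter_upwards [hfin, ae_restrict_of_ae hpos] with x h3 h4
      simp only [Pi.mul_apply]
      rw [mul_assoc, ← ENNReal.rpow_add _ _ h4.ne' h3.ne, add_neg_cancel, ENNReal.rpow_zero,
        mul_one]
    · congr 2
      · refine lintegral_congr fun x => ?_
        rw [ENNReal.mul_rpow_of_nonneg _ _ hp0.le, ← ENNReal.rpow_mul, one_div,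
          inv_mul_cancel₀ hp0.ne', ENNReal.rpow_one]
      · refine lintegral_congr fun x => ?_
        rw [← ENNReal.rpow_mul]
        congr 1
        rw [hq]
        have : p - 1 ≠ 0 := by linarith
        field_simp
  have h3 : (∫⁻ x in Ioc a b, F x) ^ p ≤ J * σ ^ (p - 1) := by
    calc (∫⁻ x in Ioc a b, F x) ^ p ≤ (J ^ (1 / p) * σ ^ (1 / q)) ^ p := by gcongr
      _ = _ := by
        rw [ENNReal.mul_rpow_of_nonneg _ _ hp0.le, ← ENNReal.rpow_mul, ← ENNReal.rpow_mul,
          one_div, inv_mul_cancel₀ hp0.ne', ENNReal.rpow_one]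
        congr 2
        rw [hq]
        have : p - 1 ≠ 0 := by linarith
        field_simp
  calc (∫⁻ x in Ioc a b, γ x) * ((∫⁻ x in Ioc a b, F x) / ℓ) ^ p
      = (∫⁻ x in Ioc a b, γ x) * ((∫⁻ x in Ioc a b, F x) ^ p / ℓ ^ p) := by
        rw [ENNReal.div_rpow_of_nonneg _ _ hp0.le]
    _ ≤ (∫⁻ x in Ioc a b, γ x) * (J * σ ^ (p - 1) / ℓ ^ p) := by gcongr
    _ = ((∫⁻ x in Ioc a b, γ x) / ℓ * (σ / ℓ) ^ (p - 1)) * J := by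
        rw [ENNReal.div_rpow_of_nonneg _ _ (by linarith)]
        have h4 : ℓ ^ p = ℓ * ℓ ^ (p - 1) := by
          nth_rewrite 2 [← ENNReal.rpow_one ℓ]
          rw [← ENNReal.rpow_add _ _ hℓ0 hℓt]
          congr 1; ring
        rw [h4]
        simp only [div_eq_mul_inv]
        rw [ENNReal.mul_inv (Or.inl hℓ0) (Or.inl hℓt)]
        ring
    _ ≤ M * J := by gcongr

/-! ### Functions on the circle -/

/-- The exceptional set is invariant under 2πℤ and null on a fundamental domain. -/
theorem ae_of_ae_restrict_period {P : ℝ → Prop} (hP : Function.Periodic P (2 * Real.pi))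
    (h : ∀ᵐ x ∂(volume.restrict (Ioc (-Real.pi) Real.pi)), P x) : ∀ᵐ x, P x := by
  have : VAddInvariantMeasure (AddSubgroup.zmultiples (2 * Real.pi)) ℝ volume :=
    ⟨fun c s _ => measure_preimage_add _ _ _⟩
  have hper : Ioc (-Real.pi) Real.pi = Ioc (-Real.pi) (-Real.pi + 2 * Real.pi) := by
    congr 1; ring
  rw [ae_restrict_iff' measurableSet_Ioc] at h
  rw [ae_iff] at h ⊢
  refine (isAddFundamentalDomain_Ioc Real.two_pi_pos (-Real.pi)).measure_zero_of_invariant _ ?_ ?_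
  · intro g
    ext x
    rw [Set.mem_vadd_set_iff_neg_vadd_mem]
    simp only [mem_ofPred_eq]
    rw [hP.map_vadd_zmultiples]
  · refine measure_mono_null ?_ h
    rintro x ⟨h1, h2⟩
    rw [← hper] at h2
    simp only [mem_ofPred_eq] at h1 ⊢
    tauto

theorem aestronglyMeasurable_of_period {f : ℝ → ℝ} (hf : Function.Periodic f (2 * Real.pi))
    (h : AEStronglyMeasurable f (volume.restrict (Ioc (-Real.pi) Real.pi))) :
    AEStronglyMeasurable f volume := by
  have hU : (⋃ n : ℤ, Ioc (-Real.pi + n • (2 * Real.pi)) (-Real.pi + (n + 1) • (2 * Real.pi))) =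
    univ := iUnion_Ioc_add_zsmul Real.two_pi_pos (-Real.pi)
  rw [← Measure.restrict_univ (μ := volume), ← hU, aestronglyMeasurable_iUnion_iff]
  intro n
  have hmp := (measurePreserving_sub_right volume (n • (2 * Real.pi))).restrict_preimage
    (measurableSet_Ioc (a := -Real.pi) (b := Real.pi))
  have h1 := h.comp_quasiMeasurePreserving hmp.quasiMeasurePreserving
  have h2 : f ∘ (fun x => x - n • (2 * Real.pi)) = f := by
    funext x
    exact hf.sub_zsmul_eq n
  rw [h2] at h1
  have h3 : Ioc (-Real.pi + n • (2 * Real.pi)) (-Real.pi + (n + 1) • (2 * Real.pi)) =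
      (fun x => x - n • (2 * Real.pi)) ⁻¹' Ioc (-Real.pi) Real.pi := by
    ext x
    simp only [zsmul_eq_mul, mem_Ioc, mem_preimage, Int.cast_add, Int.cast_one]
    constructor <;> rintro ⟨h1, h2⟩ <;> constructor <;> linarith
  rwa [h3]

/-- Positivity of the weight almost everywhere lets measurability and essential bounds pass from the
weighted measure back to Lebesgue measure. -/
theorem restrict_absolutelyContinuous_wMeasure {γ : ℝ → ℝ≥0∞} (hγ : IsWeight γ) :
    volume.restrict (Ioc (-Real.pi) Real.pi) ≪ wMeasure γ := by
  refine withDensity_absolutelyContinuous' hγ.aemeasurable.restrict ?_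
  filter_upwards [ae_restrict_of_ae hγ.pos] with x hx using hx.ne'

theorem wMeasure_absolutelyContinuous (γ : ℝ → ℝ≥0∞) : wMeasure γ ≪ volume :=
  (withDensity_absolutelyContinuous _ _).trans Measure.restrict_le_self.absolutelyContinuous

theorem MemL.aestronglyMeasurable {p : ℝ≥0∞} {γ : ℝ → ℝ≥0∞} {f : ℝ → ℝ} (hγ : IsWeight γ)
    (hf : MemL p γ f) : AEStronglyMeasurable f volume :=
  aestronglyMeasurable_of_period hf.1
    (hf.2.aestronglyMeasurable.mono_ac (restrict_absolutelyContinuous_wMeasure hγ))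

theorem MemAS.isWeight {p : ℝ≥0∞} (hp : 1 ≤ p) {γ : ℝ → ℝ≥0∞} (h : MemAS p γ) : IsWeight γ := by
  obtain ⟨h1, h2, h3⟩ := h
  rcases hp.eq_or_lt with rfl | hp1
  · exact (h1 rfl).1
  · rcases eq_or_ne p ∞ with rfl | hpt
    · exact (h3 rfl).1
    · exact (h2 hp1 hpt.lt_top).1

theorem wNorm_congr_ae {p : ℝ≥0∞} {γ : ℝ → ℝ≥0∞} {f g : ℝ → ℝ} (h : f =ᵐ[volume] g) :
    wNorm p γ f = wNorm p γ g :=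
  eLpNorm_congr_ae ((wMeasure_absolutelyContinuous γ).ae_eq h)

theorem wNorm_add_le {p : ℝ≥0∞} (hp : 1 ≤ p) {γ : ℝ → ℝ≥0∞} {f g : ℝ → ℝ}
    (hf : AEStronglyMeasurable f volume) (hg : AEStronglyMeasurable g volume) :
    wNorm p γ (fun x => f x + g x) ≤ wNorm p γ f + wNorm p γ g :=
  eLpNorm_add_le (hf.mono_ac (wMeasure_absolutelyContinuous γ))
    (hg.mono_ac (wMeasure_absolutelyContinuous γ)) hp

theorem wNorm_sub_le {p : ℝ≥0∞} (hp : 1 ≤ p) {γ : ℝ → ℝ≥0∞} {f g : ℝ → ℝ}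
    (hf : AEStronglyMeasurable f volume) (hg : AEStronglyMeasurable g volume) :
    wNorm p γ (fun x => f x - g x) ≤ wNorm p γ f + wNorm p γ g :=
  eLpNorm_sub_le (hf.mono_ac (wMeasure_absolutelyContinuous γ))
    (hg.mono_ac (wMeasure_absolutelyContinuous γ)) hp

theorem wNorm_const_mul {p : ℝ≥0∞} {γ : ℝ → ℝ≥0∞} (c : ℝ) (f : ℝ → ℝ) :
    wNorm p γ (fun x => c * f x) = ENNReal.ofReal |c| * wNorm p γ f := by
  have := eLpNorm_const_smul c f p (wMeasure γ)
  rw [Real.enorm_eq_ofReal_abs] at this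
  exact this

theorem wNorm_rpow_eq {p : ℝ≥0∞} (hp : 1 ≤ p) (hpt : p ≠ ∞) {γ : ℝ → ℝ≥0∞} (hγ : AEMeasurable γ)
    {f : ℝ → ℝ} (hf : AEStronglyMeasurable f volume) :
    wNorm p γ f =
      (∫⁻ x in Ioc (-Real.pi) Real.pi, ‖f x‖ₑ ^ p.toReal * γ x) ^ (1 / p.toReal) := by
  rw [wNorm, eLpNorm_eq_lintegral_rpow_enorm_toReal (by positivity) hpt, wMeasure,
    lintegral_withDensity_eq_lintegral_mul₀' hγ.restrict]
  · congr 1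
    refine lintegral_congr fun x => ?_
    simp [mul_comm]
  · exact (hf.enorm.pow_const _).mono_ac ((withDensity_absolutelyContinuous _ _).trans
      Measure.restrict_le_self.absolutelyContinuous)

/-! ### Convolution operators -/

/-- The kernels `R` with `|R t| ≤ A / (1 + t ^ 2)`. -/
structure IsKernel (A : ℝ) (R : ℝ → ℝ) : Prop where
  measurable : Measurable R
  bound : ∀ t, |R t| ≤ A / (1 + t ^ 2)

theorem IsKernel.nonneg {A : ℝ} {R : ℝ → ℝ} (h : IsKernel A R) : 0 ≤ A := by
  have := (abs_nonneg _).trans (h.bound 0)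
  simpa using this

theorem IsKernel.integrable {A : ℝ} {R : ℝ → ℝ} (h : IsKernel A R) : Integrable R := by
  refine (integrable_inv_one_add_sq.const_mul A).mono' h.measurable.aestronglyMeasurable ?_
  exact Filter.Eventually.of_forall fun t => h.bound t

/-- The operator `f ↦ ∫ R(t) f(x + v t) dt`. -/
noncomputable def conv (R : ℝ → ℝ) (v : ℝ) (f : ℝ → ℝ) (x : ℝ) : ℝ :=
  ∫ t, R t * f (x + v * t)

theorem aestronglyMeasurable_conv {R : ℝ → ℝ} (hR : Measurable R) (v : ℝ)
    {f : ℝ → ℝ} (hf : AEStronglyMeasurable f volume) :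
    AEStronglyMeasurable (conv R v f) volume := by
  have h1 := hf.comp_quasiMeasurePreserving (quasiMeasurePreserving_add_mul v)
  have h2 : AEStronglyMeasurable (fun z : ℝ × ℝ => R z.2 * f (z.1 + v * z.2))
      ((volume : Measure ℝ).prod volume) :=
    (hR.comp measurable_snd).aestronglyMeasurable.mul h1
  exact h2.integral_prod_right'

theorem conv_periodic (R : ℝ → ℝ) (v : ℝ) {f : ℝ → ℝ} (hf : Function.Periodic f (2 * Real.pi)) :
    Function.Periodic (conv R v f) (2 * Real.pi) := by
  intro x
  simp only [conv]
  congr 1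
  funext t
  rw [show x + 2 * Real.pi + v * t = x + v * t + 2 * Real.pi by ring, hf]

theorem enorm_conv_le {A : ℝ} {R : ℝ → ℝ} (hR : IsKernel A R) (v : ℝ) (f : ℝ → ℝ) (x : ℝ) :
    ‖conv R v f x‖ₑ ≤ ENNReal.ofReal A * poissonMajorant v (fun x => ‖f x‖ₑ) x := by
  refine (enorm_integral_le_lintegral_enorm _).trans ?_
  rw [poissonMajorant, ← lintegral_const_mul' _ _ ENNReal.ofReal_ne_top]
  refine lintegral_mono fun t => ?_
  rw [enorm_mul, ← mul_assoc, ← ENNReal.ofReal_mul hR.nonneg, mul_one_div]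
  gcongr
  rw [Real.enorm_eq_ofReal_abs]
  exact ENNReal.ofReal_le_ofReal (hR.bound t)

/-- `B` bounds all convolution operators on `L_{p,γ}`, relative to the size of the kernel. -/
def ConvBound (p : ℝ≥0∞) (γ : ℝ → ℝ≥0∞) (B : ℝ≥0) : Prop :=
  ∀ (A : ℝ) (R : ℝ → ℝ), IsKernel A R → ∀ v : ℝ, 0 < v → ∀ f : ℝ → ℝ,
    Function.Periodic f (2 * Real.pi) → AEStronglyMeasurable f volume →
    wNorm p γ (conv R v f) ≤ B * ENNReal.ofReal A * wNorm p γ f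

theorem MeanIneq.convBound {p : ℝ≥0∞} (hp : 1 ≤ p) (hpt : p ≠ ∞) {γ : ℝ → ℝ≥0∞} (hγ : IsWeight γ)
    {D : ℝ≥0} (hD : MeanIneq D p.toReal γ) :
    ConvBound p γ ((16 ^ p.toReal * (3 * 3 ^ p.toReal * D)) ^ (1 / p.toReal)) := by
  intro A R hR v hv f hf hfm
  have hp1 : 1 ≤ p.toReal := by
    rw [← ENNReal.toReal_one]
    exact ENNReal.toReal_mono hpt hp
  have hp0 : 0 ≤ p.toReal := by linarith
  have hpne : p.toReal ≠ 0 := by linarith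
  have hF : Function.Periodic (fun x => ‖f x‖ₑ) (2 * Real.pi) := fun x => by simp only [hf x]
  have key := lintegral_poissonMajorant_rpow_le hp1 hD hγ.aemeasurable hγ.periodic hfm.enorm hF hv
  have hc : (((16 ^ p.toReal * (3 * 3 ^ p.toReal * D)) ^ (1 / p.toReal) : ℝ≥0) : ℝ≥0∞) =
      (16 ^ p.toReal * (3 * 3 ^ p.toReal * D)) ^ (1 / p.toReal) := by
    rw [ENNReal.coe_rpow_of_nonneg _ (by positivity)]
    push_cast
    rw [ENNReal.coe_rpow_of_nonneg _ hp0, ENNReal.coe_rpow_of_nonneg _ hp0]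
    simp
  rw [wNorm_rpow_eq hp hpt hγ.aemeasurable (aestronglyMeasurable_conv hR.measurable v hfm),
    wNorm_rpow_eq hp hpt hγ.aemeasurable hfm, hc]
  have hA : ENNReal.ofReal A = (ENNReal.ofReal A ^ p.toReal) ^ (1 / p.toReal) := by
    rw [← ENNReal.rpow_mul, mul_one_div_cancel hpne, ENNReal.rpow_one]
  rw [hA, ← ENNReal.mul_rpow_of_nonneg _ _ (by positivity),
    ← ENNReal.mul_rpow_of_nonneg _ _ (by positivity)]
  refine ENNReal.rpow_le_rpow ?_ (by positivity)
  calc ∫⁻ x in Ioc (-Real.pi) Real.pi, ‖conv R v f x‖ₑ ^ p.toReal * γ x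
      ≤ ∫⁻ x in Ioc (-Real.pi) Real.pi, ENNReal.ofReal A ^ p.toReal *
          (poissonMajorant v (fun x => ‖f x‖ₑ) x ^ p.toReal * γ x) := by
        refine lintegral_mono fun x => ?_
        rw [← mul_assoc, ← ENNReal.mul_rpow_of_nonneg _ _ hp0]
        gcongr
        exact enorm_conv_le hR v f x
    _ = ENNReal.ofReal A ^ p.toReal * ∫⁻ x in Ioc (-Real.pi) Real.pi,
          (poissonMajorant v (fun x => ‖f x‖ₑ) x ^ p.toReal * γ x) :=
        lintegral_const_mul' _ _ (ENNReal.rpow_ne_top_of_nonneg hp0 ENNReal.ofReal_ne_top)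
    _ ≤ _ := by
        refine (mul_le_mul_right key _).trans (le_of_eq ?_)
        ring

/-- The constant is the mass π of 1/(1+t²), which controls the L¹ norm of the kernel. -/
theorem convBound_top {γ : ℝ → ℝ≥0∞} (hγ : IsWeight γ) :
    ConvBound ∞ γ (Real.toNNReal Real.pi) := by
  intro A R hR v hv f hf hfm
  set N := wNorm ∞ γ f with hN
  have h1 : ∀ᵐ x, ‖f x‖ₑ ≤ N := by
    refine ae_of_ae_restrict_period (fun x => by simp only [hf x]) ?_
    refine (restrict_absolutelyContinuous_wMeasure hγ).ae_le ?_
    simp only [hN, wNorm, eLpNorm_exponent_top]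
    exact ae_le_eLpNormEssSup
  have h2 (x : ℝ) : ∀ᵐ t : ℝ, ‖f (x + v * t)‖ₑ ≤ N := by
    have hq : Measure.QuasiMeasurePreserving (fun t : ℝ => x + v * t) volume volume := by
      refine ⟨by fun_prop, ?_⟩
      have : (fun t : ℝ => x + v * t) = (fun t => x + t) ∘ (fun t => v * t) := rfl
      rw [this, ← Measure.map_map (by fun_prop) (by fun_prop), Real.map_volume_mul_left hv.ne',
        Measure.map_smul, (measurePreserving_add_left volume x).map_eq]
      exact Measure.smul_absolutelyContinuous
    exact hq.ae h1
  have h3 : ∫⁻ t : ℝ, ENNReal.ofReal (1 / (1 + t ^ 2)) = ENNReal.ofReal Real.pi := by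
    simp_rw [one_div]
    rw [← integral_univ_inv_one_add_sq, ofReal_integral_eq_lintegral_ofReal
      integrable_inv_one_add_sq (Filter.Eventually.of_forall fun t => by positivity)]
  have h4 (x : ℝ) : ‖conv R v f x‖ₑ ≤ ENNReal.ofReal Real.pi * ENNReal.ofReal A * N := by
    refine (enorm_conv_le hR v f x).trans ?_
    have : poissonMajorant v (fun x => ‖f x‖ₑ) x ≤ ENNReal.ofReal Real.pi * N := by
      rw [← h3, ← lintegral_mul_const'' _ (by fun_prop)]
      refine lintegral_mono_ae ?_
      filter_upwards [h2 x] with t ht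
      gcongr
    calc _ ≤ ENNReal.ofReal A * (ENNReal.ofReal Real.pi * N) := by gcongr
      _ = _ := by ring
  rw [wNorm, eLpNorm_exponent_top]
  exact eLpNormEssSup_le_of_ae_enorm_bound (Filter.Eventually.of_forall h4)

/-- The order of quantifiers is the point: B is fixed before the weight, so every later constant is
uniform over the class. -/
theorem exists_convBound {p : ℝ≥0∞} (hp : 1 ≤ p) (M : ℝ≥0) {c : ℝ≥0} (hc : 0 < c) :
    ∃ B : ℝ≥0, ∀ γ : ℝ → ℝ≥0∞, MemAS p γ → weightConst p γ ≤ M →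
      (p = 1 → ∀ᵐ x, (c : ℝ≥0∞) ≤ γ x) → ConvBound p γ B := by
  rcases eq_or_ne p ∞ with rfl | hpt
  · exact ⟨_, fun γ hγ _ _ => convBound_top (hγ.isWeight hp)⟩
  rcases hp.eq_or_lt with rfl | hp1
  · refine ⟨_, fun γ hγ hM hγc => MeanIneq.convBound hp hpt (hγ.isWeight hp) (D := M / c) ?_⟩
    rw [ENNReal.toReal_one]
    exact meanIneq_one hc (by simpa [weightConst] using hM) (hγc rfl)
  · refine ⟨_, fun γ hγ hM _ => MeanIneq.convBound hp hpt (hγ.isWeight hp) (D := M) ?_⟩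
    refine meanIneq_of_muckenhoupt ?_ (hγ.2.1 hp1 hpt.lt_top)
      (by simpa [weightConst, hp1.ne', hpt] using hM)
    rw [← ENNReal.toReal_one]
    exact (ENNReal.toReal_lt_toReal (by simp) hpt).2 hp1

/-! ### Integrability of the functions of L_{p,γ} -/

theorem MeanIneq.lintegral_lt_top {p : ℝ} (hp : 1 ≤ p) {γ F : ℝ → ℝ≥0∞} (hγ : IsWeight γ)
    {D : ℝ≥0} (hD : MeanIneq D p γ) (hF : AEMeasurable F)
    (hfin : ∫⁻ x in Ioc (-Real.pi) Real.pi, F x ^ p * γ x < ∞) :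
    ∫⁻ x in Ioc (-Real.pi) Real.pi, F x < ∞ := by
  have hpi := Real.pi_pos
  have h := (hD (-Real.pi) Real.pi (by linarith) (by linarith) F hF).trans_lt
    (ENNReal.mul_lt_top ENNReal.coe_lt_top hfin)
  have h0 : ∫⁻ x in Ioc (-Real.pi) Real.pi, γ x ≠ 0 := by
    intro h0
    rw [lintegral_eq_zero_iff' hγ.aemeasurable.restrict] at h0
    have h1 : ∀ᵐ x ∂(volume.restrict (Ioc (-Real.pi) Real.pi)), False := by
      filter_upwards [h0, ae_restrict_of_ae hγ.pos] with x h1 h2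
      exact h2.ne' h1
    rw [Filter.eventually_false_iff_eq_bot, ae_eq_bot, Measure.restrict_eq_zero,
      Real.volume_Ioc] at h1
    simp only [ENNReal.ofReal_eq_zero] at h1
    linarith
  -- Since γ has positive mass, an infinite integral of F would make the left side of the mean
  -- inequality on a full period infinite.
  by_contra h2
  rw [not_lt, top_le_iff] at h2
  rw [h2, ENNReal.top_div_of_ne_top ENNReal.ofReal_ne_top, ENNReal.top_rpow_of_pos (by linarith),
    ENNReal.mul_top h0] at h
  exact lt_irrefl _ h

theorem MemAS.exists_meanIneq {p : ℝ≥0∞} (hp : 1 ≤ p) (hpt : p ≠ ∞) {γ : ℝ → ℝ≥0∞}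
    (hγ : MemAS p γ) : ∃ D, MeanIneq D p.toReal γ := by
  rcases hp.eq_or_lt with rfl | hp1
  · obtain ⟨-, hM, c, hc, hγc⟩ := hγ.1 rfl
    refine ⟨(meanConst γ).toNNReal / c, ?_⟩
    rw [ENNReal.toReal_one]
    exact meanIneq_one hc (by rw [ENNReal.coe_toNNReal hM.ne]) hγc
  · have h := hγ.2.1 hp1 hpt.lt_top
    refine ⟨(muckenhouptConst p.toReal γ).toNNReal, meanIneq_of_muckenhoupt ?_ h ?_⟩
    · rw [← ENNReal.toReal_one]
      exact (ENNReal.toReal_lt_toReal (by simp) hpt).2 hp1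
    · rw [ENNReal.coe_toNNReal h.2.2.ne]

theorem MemL.integrableOn {p : ℝ≥0∞} (hp : 1 ≤ p) {γ : ℝ → ℝ≥0∞} (hγ : MemAS p γ) {f : ℝ → ℝ}
    (hf : MemL p γ f) : IntegrableOn f (Ioc (-Real.pi) Real.pi) := by
  have hw := hγ.isWeight hp
  have hfm := hf.aestronglyMeasurable hw
  refine ⟨hfm.restrict, ?_⟩
  rcases eq_or_ne p ∞ with rfl | hpt
  · have h1 : MemLp f ∞ (volume.restrict (Ioc (-Real.pi) Real.pi)) := by
      refine ⟨hfm.restrict, lt_of_le_of_lt ?_ hf.2.2⟩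
      simp only [eLpNorm_exponent_top]
      exact eLpNormEssSup_mono_measure _ (restrict_absolutelyContinuous_wMeasure hw)
    exact (h1.integrable le_top).hasFiniteIntegral
  · obtain ⟨D, hD⟩ := hγ.exists_meanIneq hp hpt
    have hp1 : 1 ≤ p.toReal := by
      rw [← ENNReal.toReal_one]
      exact ENNReal.toReal_mono hpt hp
    refine hD.lintegral_lt_top hp1 hw hfm.enorm ?_
    have h1 : wNorm p γ f < ∞ := hf.2.2
    rw [wNorm_rpow_eq hp hpt hw.aemeasurable hfm] at h1
    exact (ENNReal.rpow_lt_top_iff_of_pos (by positivity)).1 h1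

/-! ### Symbols and Fourier coefficients -/

/-- The character `e^{iy}`. -/
noncomputable def expI (y : ℝ) : ℂ := Complex.exp (y * Complex.I)

theorem expI_add (a b : ℝ) : expI (a + b) = expI a * expI b := by
  simp only [expI]
  rw [← Complex.exp_add]
  push_cast; ring_nf

@[simp] theorem expI_zero : expI 0 = 1 := by simp [expI]

@[simp] theorem norm_expI (y : ℝ) : ‖expI y‖ = 1 := Complex.norm_exp_ofReal_mul_I y

theorem expI_neg (y : ℝ) : expI (-y) = starRingEnd ℂ (expI y) := by
  rw [expI, expI, ← Complex.exp_conj]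
  simp

theorem expI_re (y : ℝ) : (expI y).re = Real.cos y := Complex.exp_ofReal_mul_I_re y

theorem expI_im (y : ℝ) : (expI y).im = Real.sin y := Complex.exp_ofReal_mul_I_im y

theorem contDiff_expI : ContDiff ℝ ⊤ expI :=
  Complex.contDiff_exp.comp ((Complex.ofRealCLM.contDiff).mul contDiff_const)

@[fun_prop] theorem continuous_expI : Continuous expI := contDiff_expI.continuous

theorem hasDerivAt_expI (y : ℝ) : HasDerivAt expI (Complex.I * expI y) y := by
  have h := ((Complex.ofRealCLM.hasDerivAt (x := y)).mul_const Complex.I).cexp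
  exact HasDerivAt.congr_deriv (f := expI) h (by simp [expI, mul_comm])

theorem hasDerivAt_expI_mul (a y : ℝ) :
    HasDerivAt (fun y => expI (a * y)) (Complex.I * a * expI (a * y)) y := by
  have h := (hasDerivAt_expI (a * y)).scomp y ((hasDerivAt_id y).const_mul a)
  exact HasDerivAt.congr_deriv (f := fun y => expI (a * y)) h (by simp; ring)

theorem expI_periodic (k : ℤ) : Function.Periodic (fun x => expI (k * x)) (2 * Real.pi) := by
  intro x
  simp only [mul_add, expI_add]
  have : expI (k * (2 * Real.pi)) = 1 := by
    rw [expI, Complex.exp_eq_one_iff]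
    exact ⟨k, by push_cast; ring⟩
  rw [this, mul_one]

/-- The symbol `∫ R(t) e^{iyt} dt` of a kernel. -/
noncomputable def symbol (R : ℝ → ℝ) (y : ℝ) : ℂ := ∫ t, (R t : ℂ) * expI (y * t)

/-- The (unnormalized) Fourier coefficients of a `2π`-periodic function. -/
noncomputable def coeff (f : ℝ → ℂ) (k : ℤ) : ℂ :=
  ∫ x in Ioc (-Real.pi) Real.pi, f x * expI (-(k * x))

theorem integrable_mul_expI {μ : Measure ℝ} {f : ℝ → ℂ} (hf : Integrable f μ) (a : ℝ) :
    Integrable (fun x => f x * expI (a * x)) μ :=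
  hf.mul_bdd (c := 1) (by fun_prop) (Filter.Eventually.of_forall fun x => by simp)

theorem integrable_mul_expI_neg {μ : Measure ℝ} {f : ℝ → ℂ} (hf : Integrable f μ) (k : ℤ) :
    Integrable (fun x => f x * expI (-(k * x))) μ := by
  simpa using integrable_mul_expI hf (-k)

theorem coeff_add {f g : ℝ → ℂ} (hf : IntegrableOn f (Ioc (-Real.pi) Real.pi))
    (hg : IntegrableOn g (Ioc (-Real.pi) Real.pi)) (k : ℤ) :
    coeff (fun x => f x + g x) k = coeff f k + coeff g k := by
  simp only [coeff, add_mul]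
  exact integral_add (integrable_mul_expI_neg hf k) (integrable_mul_expI_neg hg k)

theorem coeff_sub {f g : ℝ → ℂ} (hf : IntegrableOn f (Ioc (-Real.pi) Real.pi))
    (hg : IntegrableOn g (Ioc (-Real.pi) Real.pi)) (k : ℤ) :
    coeff (fun x => f x - g x) k = coeff f k - coeff g k := by
  simp only [coeff, sub_mul]
  exact integral_sub (integrable_mul_expI_neg hf k) (integrable_mul_expI_neg hg k)

theorem integral_period_expI (k : ℤ) :
    ∫ x in Ioc (-Real.pi) Real.pi, expI (k * x) = if k = 0 then (2 * Real.pi : ℂ) else 0 := by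
  have hpi := Real.pi_pos
  split_ifs with h
  · subst h
    simp [two_mul, hpi.le]
  · rw [← intervalIntegral.integral_of_le (by linarith)]
    have hk : Complex.I * (k : ℝ) ≠ 0 := by simp [h]
    have h1 : ∀ x ∈ uIcc (-Real.pi) Real.pi,
        HasDerivAt (fun x => (Complex.I * (k : ℝ))⁻¹ * expI (k * x)) (expI (k * x)) x := by
      intro x _
      exact ((hasDerivAt_expI_mul (k : ℝ) x).const_mul (Complex.I * (k : ℝ))⁻¹).congr_deriv
        (by rw [← mul_assoc, inv_mul_cancel₀ hk, one_mul])
    rw [intervalIntegral.integral_eq_sub_of_hasDerivAt h1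
      (Continuous.intervalIntegrable (by fun_prop) _ _)]
    have h2 := expI_periodic k (-Real.pi)
    simp only at h2
    rw [show -Real.pi + 2 * Real.pi = Real.pi by ring] at h2
    rw [h2, sub_self]

theorem coeff_sum_expI (s : Finset ℤ) (d : ℤ → ℂ) (k : ℤ) :
    coeff (fun x => ∑ j ∈ s, d j * expI (j * x)) k = if k ∈ s then 2 * Real.pi * d k else 0 := by
  simp only [coeff, Finset.sum_mul]
  rw [integral_finsetSum]
  · have h (j : ℤ) : ∫ x in Ioc (-Real.pi) Real.pi, d j * expI (j * x) * expI (-(k * x)) =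
        if k = j then 2 * Real.pi * d j else 0 := by
      have h1 (x : ℝ) : d j * expI (j * x) * expI (-(k * x)) =
          d j * expI ((j - k : ℤ) * x) := by
        rw [mul_assoc, ← expI_add]
        congr 2; push_cast; ring
      simp_rw [h1]
      rw [integral_const_mul, integral_period_expI]
      by_cases hjk : k = j
      · simp [hjk, mul_comm]
      · have : j - k ≠ 0 := sub_ne_zero.2 (Ne.symm hjk)
        simp [hjk, this]
    simp_rw [h]
    simp
  · intro j _
    exact Continuous.integrableOn_Ioc (by fun_prop)

/-- Integration against h is a functional on continuous functions, bounded for the sup norm, that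
kills all characters; their span is dense. -/
theorem integral_mul_continuous_eq_zero {h : ℝ → ℂ}
    (hi : IntegrableOn h (Ioc (-Real.pi) Real.pi)) (h0 : ∀ k, coeff h k = 0)
    [Fact (0 < 2 * Real.pi)] (g : C(AddCircle (2 * Real.pi), ℂ)) :
    ∫ x in Ioc (-Real.pi) Real.pi, h x * g (x : AddCircle (2 * Real.pi)) = 0 := by
  have hcont (g : C(AddCircle (2 * Real.pi), ℂ)) :
      Continuous (fun x : ℝ => g (x : AddCircle (2 * Real.pi))) :=
    g.continuous.comp (AddCircle.continuous_mk' _)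
  have hint (g : C(AddCircle (2 * Real.pi), ℂ)) : Integrable
      (fun x : ℝ => h x * g (x : AddCircle (2 * Real.pi)))
      (volume.restrict (Ioc (-Real.pi) Real.pi)) :=
    hi.mul_bdd (c := ‖g‖) (hcont g).aestronglyMeasurable
      (Filter.Eventually.of_forall fun x => g.norm_coe_le_norm _)
  let Λ : C(AddCircle (2 * Real.pi), ℂ) →ₗ[ℂ] ℂ :=
    { toFun := fun g => ∫ x in Ioc (-Real.pi) Real.pi, h x * g (x : AddCircle (2 * Real.pi))
      map_add' := fun g₁ g₂ => by
        simp only [ContinuousMap.add_apply, mul_add]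
        exact integral_add (hint g₁) (hint g₂)
      map_smul' := fun c g => by
        simp only [ContinuousMap.smul_apply, smul_eq_mul, RingHom.id_apply]
        rw [← integral_const_mul]
        congr 1
        funext x; ring }
  let Λ' : C(AddCircle (2 * Real.pi), ℂ) →L[ℂ] ℂ :=
    Λ.mkContinuous (∫ x in Ioc (-Real.pi) Real.pi, ‖h x‖) fun g => by
      rw [← integral_mul_const]
      refine (norm_integral_le_integral_norm _).trans ?_
      refine integral_mono (hint g).norm (hi.norm.mul_const _) fun x => ?_
      simp only [norm_mul]
      gcongr
      exact g.norm_coe_le_norm _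
  have hker : (Submodule.span ℂ (range (@fourier (2 * Real.pi)))).topologicalClosure ≤
      LinearMap.ker (Λ' : C(AddCircle (2 * Real.pi), ℂ) →ₗ[ℂ] ℂ) := by
    refine Submodule.topologicalClosure_minimal _ ?_ Λ'.isClosed_ker
    rw [Submodule.span_le]
    rintro _ ⟨n, rfl⟩
    have := h0 (-n)
    simp only [SetLike.mem_coe, LinearMap.mem_ker]
    refine Eq.trans ?_ this
    change ∫ x in Ioc (-Real.pi) Real.pi, h x * fourier n (x : AddCircle (2 * Real.pi)) = _
    rw [coeff]
    congr 1
    funext x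
    rw [fourier_coe_apply, expI]
    congr 2
    have : (Real.pi : ℂ) ≠ 0 := by exact_mod_cast Real.pi_ne_zero
    push_cast
    field_simp
  rw [span_fourier_closure_eq_top] at hker
  exact hker (Submodule.mem_top (x := g))

theorem ae_eq_zero_of_coeff_eq_zero {h : ℝ → ℂ} (hper : Function.Periodic h (2 * Real.pi))
    (hi : IntegrableOn h (Ioc (-Real.pi) Real.pi)) (h0 : ∀ k, coeff h k = 0) :
    ∀ᵐ x, h x = 0 := by
  have : Fact (0 < 2 * Real.pi) := ⟨Real.two_pi_pos⟩
  have hpi := Real.pi_pos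
  refine ae_of_ae_restrict_period (fun x => by simp only [hper x]) ?_
  rw [← restrict_Ioo_eq_restrict_Ioc, ae_restrict_iff' measurableSet_Ioo]
  refine isOpen_Ioo.ae_eq_zero_of_integral_contDiff_smul_eq_zero
    (hi.mono_set Ioo_subset_Ioc_self).locallyIntegrableOn ?_
  intro g hg _ hgs
  have hz (x : ℝ) (hx : x ∉ Ioo (-Real.pi) Real.pi) : g x = 0 :=
    image_eq_zero_of_notMem_tsupport fun hx' => hx (hgs hx')
  have hper2 : -Real.pi + 2 * Real.pi = Real.pi := by ring
  -- A test function supported inside the open period vanishes at both endpoints, so it glues to a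
  -- continuous function on the circle.
  let G : C(AddCircle (2 * Real.pi), ℂ) :=
    ⟨AddCircle.liftIco (2 * Real.pi) (-Real.pi) (fun x => (g x : ℂ)),
      AddCircle.liftIco_continuous (by rw [hper2, hz _ (by simp), hz _ (by simp)])
        (Complex.continuous_ofReal.comp hg.continuous).continuousOn⟩
  have h1 := integral_mul_continuous_eq_zero hi h0 G
  have h2 : ∫ x, g x • h x = ∫ x in Ioo (-Real.pi) Real.pi, g x • h x := by
    rw [setIntegral_eq_integral_of_forall_compl_eq_zero]
    intro x hx
    rw [hz x hx, zero_smul]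
  rw [h2, ← h1, ← restrict_Ioo_eq_restrict_Ioc]
  refine setIntegral_congr_fun measurableSet_Ioo fun x hx => ?_
  have : G (x : AddCircle (2 * Real.pi)) = g x :=
    AddCircle.liftIco_coe_apply (f := fun x => (g x : ℂ)) ⟨hx.1.le, by rw [hper2]; exact hx.2⟩
  simp only [this, Complex.real_smul, mul_comm]

theorem integral_period_comp_add {f : ℝ → ℂ} (hf : Function.Periodic f (2 * Real.pi)) (s : ℝ) :
    ∫ x in Ioc (-Real.pi) Real.pi, f (x + s) = ∫ x in Ioc (-Real.pi) Real.pi, f x := by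
  have hpi := Real.pi_pos
  rw [← intervalIntegral.integral_of_le (by linarith),
    ← intervalIntegral.integral_of_le (by linarith), intervalIntegral.integral_comp_add_right]
  have h := hf.intervalIntegral_add_eq (-Real.pi + s) (-Real.pi)
  rw [show -Real.pi + s + 2 * Real.pi = Real.pi + s by ring,
    show -Real.pi + 2 * Real.pi = Real.pi by ring] at h
  exact h

theorem integrable_conv_prod {R f : ℝ → ℝ} (hR : Integrable R)
    (hf : Function.Periodic f (2 * Real.pi)) (hfm : AEStronglyMeasurable f volume)
    (hfi : IntegrableOn f (Ioc (-Real.pi) Real.pi)) (v : ℝ) :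
    Integrable (fun z : ℝ × ℝ => R z.2 * f (z.1 + v * z.2))
      ((volume.restrict (Ioc (-Real.pi) Real.pi)).prod volume) := by
  have hm : AEStronglyMeasurable (fun z : ℝ × ℝ => R z.2 * f (z.1 + v * z.2))
      ((volume : Measure ℝ).prod volume) :=
    hR.aestronglyMeasurable.comp_snd.mul
      (hfm.comp_quasiMeasurePreserving (quasiMeasurePreserving_add_mul v))
  have hm' : AEStronglyMeasurable (fun z : ℝ × ℝ => R z.2 * f (z.1 + v * z.2))
      ((volume.restrict (Ioc (-Real.pi) Real.pi)).prod volume) :=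
    hm.mono_measure (by
      have h := Measure.prod_restrict (μ := (volume : Measure ℝ)) (ν := (volume : Measure ℝ))
        (Ioc (-Real.pi) Real.pi) univ
      rw [Measure.restrict_univ] at h
      rw [h]
      exact Measure.restrict_le_self)
  refine ⟨hm', ?_⟩
  rw [HasFiniteIntegral, lintegral_prod_symm _ hm'.enorm]
  have hper : Function.Periodic (fun x => ‖f x‖ₑ) (2 * Real.pi) := fun x => by simp only [hf x]
  simp_rw [enorm_mul, lintegral_const_mul' _ _ enorm_ne_top]
  simp_rw [lintegral_period_comp_add hper]
  rw [lintegral_mul_const' _ _ hfi.2.ne]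
  exact ENNReal.mul_lt_top hR.2 hfi.2

theorem integrableOn_conv {R f : ℝ → ℝ} (hR : Integrable R)
    (hf : Function.Periodic f (2 * Real.pi)) (hfm : AEStronglyMeasurable f volume)
    (hfi : IntegrableOn f (Ioc (-Real.pi) Real.pi)) (v : ℝ) :
    IntegrableOn (conv R v f) (Ioc (-Real.pi) Real.pi) :=
  (integrable_conv_prod hR hf hfm hfi v).integral_prod_left

theorem coeff_conv {R f : ℝ → ℝ} (hR : Integrable R)
    (hf : Function.Periodic f (2 * Real.pi)) (hfm : AEStronglyMeasurable f volume)
    (hfi : IntegrableOn f (Ioc (-Real.pi) Real.pi)) (v : ℝ) (k : ℤ) :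
    coeff (fun x => (conv R v f x : ℂ)) k = symbol R (k * v) * coeff (fun x => (f x : ℂ)) k := by
  have hprod : Integrable (fun z : ℝ × ℝ => (R z.2 * f (z.1 + v * z.2) : ℂ) *
      expI (-(k * z.1))) ((volume.restrict (Ioc (-Real.pi) Real.pi)).prod volume) := by
    have h := (integrable_conv_prod hR hf hfm hfi v).ofReal (𝕜 := ℂ)
    have h2 := Integrable.mul_bdd (c := 1) (g := fun z : ℝ × ℝ => expI (-(k * z.1))) h
      (by fun_prop) (Filter.Eventually.of_forall fun x => by simp)
    refine h2.congr (Filter.Eventually.of_forall fun z => ?_)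
    simp
  have hg : Function.Periodic (fun x => (f x : ℂ) * expI (-(k * x))) (2 * Real.pi) := by
    intro x
    have := expI_periodic (-k) x
    simp only [Int.cast_neg, neg_mul] at this
    simp only [hf x, this]
  calc coeff (fun x => (conv R v f x : ℂ)) k
      = ∫ x in Ioc (-Real.pi) Real.pi, ∫ t, (R t * f (x + v * t) : ℂ) * expI (-(k * x)) := by
        simp only [coeff, conv]
        refine integral_congr_ae (Filter.Eventually.of_forall fun x => ?_)
        simp only
        rw [integral_mul_const, ← integral_complex_ofReal]
        simp
    _ = ∫ t, ∫ x in Ioc (-Real.pi) Real.pi, (R t * f (x + v * t) : ℂ) * expI (-(k * x)) :=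
        integral_integral_swap hprod
    _ = ∫ t, (R t : ℂ) * expI (k * v * t) * coeff (fun x => (f x : ℂ)) k := by
        refine integral_congr_ae (Filter.Eventually.of_forall fun t => ?_)
        simp only
        rw [coeff, ← integral_period_comp_add hg (v * t), ← integral_const_mul]
        refine integral_congr_ae (Filter.Eventually.of_forall fun x => ?_)
        simp only
        have : expI (-(k * x)) = expI (k * v * t) * expI (-(k * (x + v * t))) := by
          rw [← expI_add]; congr 1; ring
        rw [this]; ring
    _ = _ := by rw [integral_mul_const, symbol]

theorem conv_re_sum {R : ℝ → ℝ} (hR : Integrable R) (v : ℝ) (s : Finset ℕ) (z : ℕ → ℂ) :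
    conv R v (fun x => (∑ k ∈ s, z k * expI (k * x)).re) =
      fun x => (∑ k ∈ s, symbol R (k * v) * z k * expI (k * x)).re := by
  funext x
  have hint (k : ℕ) : Integrable (fun t => (R t : ℂ) * expI (k * v * t)) :=
    integrable_mul_expI hR.ofReal _
  have h1 (t : ℝ) : R t * (∑ k ∈ s, z k * expI (k * (x + v * t))).re =
      Complex.reCLM (∑ k ∈ s, (R t : ℂ) * expI (k * v * t) * (z k * expI (k * x))) := by
    rw [Complex.reCLM_apply, ← Complex.re_ofReal_mul, Finset.mul_sum]
    congr 1
    refine Finset.sum_congr rfl fun k _ => ?_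
    rw [mul_add, expI_add, mul_assoc (k : ℝ)]
    ring
  simp only [conv]
  simp_rw [h1]
  rw [ContinuousLinearMap.integral_comp_comm _
    (integrable_finsetSum _ fun k _ => (hint k).mul_const _), integral_finsetSum _
    fun k _ => (hint k).mul_const _]
  simp only [Complex.reCLM_apply, integral_mul_const, symbol]
  congr 1
  refine Finset.sum_congr rfl fun k _ => ?_
  ring

open scoped FourierTransform

/-! ### Multipliers with an integrable second derivative -/

theorem fourier_eq_integral_expI (m : ℝ → ℂ) (x : ℝ) :
    𝓕 m x = ∫ y, m y * expI (-(2 * Real.pi * x) * y) := by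
  rw [Real.fourier_real_eq_integral_exp_smul]
  congr 1
  funext y
  rw [smul_eq_mul, mul_comm, expI]
  congr 3
  push_cast; ring

theorem norm_fourier_le (m : ℝ → ℂ) (x : ℝ) : ‖𝓕 m x‖ ≤ ∫ y, ‖m y‖ := by
  rw [fourier_eq_integral_expI]
  refine (norm_integral_le_integral_norm _).trans (le_of_eq ?_)
  simp

theorem continuous_fourier_of_integrable {m : ℝ → ℂ} (hm : Integrable m) : Continuous (𝓕 m) := by
  have h : 𝓕 m = fun x => ∫ y, m y * expI (-(2 * Real.pi * x) * y) := by
    funext x; exact fourier_eq_integral_expI m x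
  rw [h]
  refine continuous_of_dominated (bound := fun y => ‖m y‖) (fun x => ?_) (fun x => ?_) hm.norm ?_
  · exact (integrable_mul_expI hm _).aestronglyMeasurable
  · exact Filter.Eventually.of_forall fun y => by simp
  · exact Filter.Eventually.of_forall fun y => by fun_prop

/-- The kernel is the rescaled Fourier transform of m. Two integrable derivatives give its quadratic
decay, hence integrability and Fourier inversion; the Hermitian symmetry of m makes it real. -/
theorem exists_kernel_of_integrable_deriv {m : ℝ → ℂ} (hm : ContDiff ℝ 2 m)
    (hsym : ∀ y, m (-y) = starRingEnd ℂ (m y)) (h0 : Integrable m) (h1 : Integrable (deriv m))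
    (h2 : Integrable (deriv (deriv m))) :
    ∃ A R, IsKernel A R ∧ ∀ y, symbol R y = m y := by
  have hm1 : ContDiff ℝ 1 (deriv m) := by
    have : ContDiff ℝ (1 + 1) m := by simpa [one_add_one_eq_two] using hm
    exact (contDiff_succ_iff_deriv.1 this).2.2
  have hpi := Real.pi_pos
  set K := 𝓕 m with hK
  have hKc : Continuous K := continuous_fourier_of_integrable h0
  set I0 := ∫ y, ‖m y‖
  set I2 := ∫ y, ‖deriv (deriv m) y‖
  have hF (x : ℝ) : (2 * Real.pi * x) ^ 2 * ‖K x‖ ≤ I2 := by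
    have e1 := congrFun (Real.fourier_deriv h1 (hm1.differentiable one_ne_zero) h2) x
    have e2 := congrFun (Real.fourier_deriv h0 (hm.differentiable two_ne_zero) h1) x
    have e3 := norm_fourier_le (deriv (deriv m)) x
    rw [e1, e2] at e3
    refine le_trans (le_of_eq ?_) e3
    simp only [smul_eq_mul, norm_mul, Complex.norm_ofNat, Complex.norm_real, Real.norm_eq_abs,
      Complex.norm_I, mul_one, abs_of_pos hpi]
    rw [← sq_abs, abs_mul, abs_of_pos (by positivity : 0 < 2 * Real.pi)]
    ring
  have hB (x : ℝ) : ‖K x‖ ≤ (I0 + I2) / (1 + (2 * Real.pi * x) ^ 2) := by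
    rw [le_div_iff₀ (by positivity)]
    linarith [hF x, norm_fourier_le m x]
  have hKint : Integrable K := by
    refine ((integrable_inv_one_add_sq.comp_mul_left' (by positivity : 2 * Real.pi ≠ 0)).const_mul
      (I0 + I2)).mono' hKc.aestronglyMeasurable (Filter.Eventually.of_forall fun x => ?_)
    exact hB x
  have hreal (x : ℝ) : ((K x).re : ℂ) = K x := by
    rw [← Complex.conj_eq_iff_re, hK, fourier_eq_integral_expI, ← integral_conj,
      ← integral_neg_eq_self]
    congr 1
    funext y
    rw [map_mul, hsym, Complex.conj_conj, ← expI_neg]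
    congr 2; ring
  have hinv (y : ℝ) : ∫ x, K x * expI (2 * Real.pi * y * x) = m y := by
    have h := congrFun (hm.continuous.fourierInv_fourier_eq h0 hKint) y
    rw [← h, Real.fourierInv_eq']
    congr 1
    funext x
    rw [smul_eq_mul, mul_comm, expI]
    congr 3
    simp; ring
  -- The substitution t = 2πx passes from the characters e^{2πixy} of the Fourier transform to the
  -- e^{iyt} of `symbol`.
  refine ⟨(2 * Real.pi)⁻¹ * (I0 + I2), fun t => (2 * Real.pi)⁻¹ * (K (t / (2 * Real.pi))).re,
    ⟨?_, fun t => ?_⟩, fun y => ?_⟩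
  · exact (continuous_const.mul (Complex.continuous_re.comp
      (hKc.comp (continuous_id.div_const _)))).measurable
  · rw [abs_mul, abs_of_pos (by positivity), mul_div_assoc]
    gcongr
    refine (Complex.abs_re_le_norm _).trans ((hB _).trans (le_of_eq ?_))
    rw [mul_div_cancel₀ _ (by positivity)]
  · rw [← hinv y, symbol]
    have h := Measure.integral_comp_div (fun x => K x * expI (2 * Real.pi * y * x)) (2 * Real.pi)
    rw [abs_of_pos (by positivity)] at h
    rw [← inv_smul_smul₀ (by positivity : (2 * Real.pi) ≠ 0)
        (∫ x, K x * expI (2 * Real.pi * y * x)),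
      ← h, ← integral_smul]
    congr 1
    funext t
    push_cast
    rw [hreal]
    simp only [Complex.real_smul]
    have : 2 * Real.pi * y * (t / (2 * Real.pi)) = y * t := by field_simp
    rw [this]
    push_cast; ring

theorem exists_kernel_of_hasCompactSupport {m : ℝ → ℂ} (hm : ContDiff ℝ 2 m)
    (hsym : ∀ y, m (-y) = starRingEnd ℂ (m y)) (hc : HasCompactSupport m) :
    ∃ A R, IsKernel A R ∧ ∀ y, symbol R y = m y := by
  have hm1 : ContDiff ℝ 1 (deriv m) := by
    have : ContDiff ℝ (1 + 1) m := by simpa [one_add_one_eq_two] using hm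
    exact (contDiff_succ_iff_deriv.1 this).2.2
  exact exists_kernel_of_integrable_deriv hm hsym (hm.continuous.integrable_of_hasCompactSupport hc)
    (hm1.continuous.integrable_of_hasCompactSupport hc.deriv)
    ((hm1.continuous_deriv le_rfl).integrable_of_hasCompactSupport hc.deriv.deriv)

theorem integrable_of_norm_le_of_le {g : ℝ → ℂ} (hg : Continuous g) {C N : ℝ}
    (hC : ∀ y, N ≤ |y| → ‖g y‖ ≤ C * (1 + y ^ 2)⁻¹) : Integrable g := by
  refine hg.locallyIntegrable.integrable_of_isBigO_cocompact
    (g := fun y : ℝ => (1 + y ^ 2)⁻¹) ?_ ⟨univ, Filter.univ_mem, ?_⟩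
  · refine Asymptotics.IsBigO.of_bound C ?_
    have h := tendsto_norm_cocompact_atTop (E := ℝ)
    filter_upwards [h.eventually_ge_atTop N] with y hy
    rw [Real.norm_of_nonneg (by positivity)]
    exact hC y hy
  · exact integrable_inv_one_add_sq.integrableOn

/-! ### The symbols of the Steklov means -/

/-- The kernel of the Steklov mean. -/
noncomputable def box : ℝ → ℝ := (Ioc 0 1).indicator fun _ => 1

/-- The kernel `S` with `I - T_v = v S_v D`. -/
noncomputable def ramp : ℝ → ℝ := (Ioc 0 1).indicator fun t => t - 1

theorem isKernel_indicator {g : ℝ → ℝ} (hg : Measurable g) (h : ∀ t ∈ Ioc (0 : ℝ) 1, |g t| ≤ 1) :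
    IsKernel 2 ((Ioc 0 1).indicator g) := by
  refine ⟨hg.indicator measurableSet_Ioc, fun t => ?_⟩
  by_cases ht : t ∈ Ioc (0 : ℝ) 1
  · rw [indicator_of_mem ht]
    refine (h t ht).trans ?_
    rw [le_div_iff₀ (by positivity)]
    nlinarith [ht.1, ht.2]
  · rw [indicator_of_notMem ht]
    simp; positivity

theorem isKernel_box : IsKernel 2 box :=
  isKernel_indicator measurable_const fun t _ => by simp

theorem isKernel_ramp : IsKernel 2 ramp :=
  isKernel_indicator (by fun_prop) fun t ht => by
    rw [abs_le]; constructor <;> linarith [ht.1, ht.2]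

theorem symbol_neg (R : ℝ → ℝ) (y : ℝ) : symbol R (-y) = starRingEnd ℂ (symbol R y) := by
  rw [symbol, symbol, ← integral_conj]
  congr 1
  funext t
  rw [map_mul, Complex.conj_ofReal, ← expI_neg, neg_mul]

theorem symbol_indicator (g : ℝ → ℝ) (y : ℝ) :
    symbol ((Ioc 0 1).indicator g) y = ∫ t in (0 : ℝ)..1, (g t : ℂ) * expI (y * t) := by
  rw [intervalIntegral.integral_of_le zero_le_one, ← integral_indicator measurableSet_Ioc, symbol]
  congr 1
  funext t
  by_cases ht : t ∈ Ioc (0 : ℝ) 1 <;> simp [ht]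

/-- A compactly supported kernel has finite moments of all orders, so its Fourier transform is
smooth. -/
theorem contDiff_symbol_indicator {g : ℝ → ℝ} (hg : Continuous g) {n : ℕ} :
    ContDiff ℝ n (symbol ((Ioc 0 1).indicator g)) := by
  have h : symbol ((Ioc 0 1).indicator g) =
      fun y => 𝓕 (fun t => (((Ioc 0 1).indicator g t : ℝ) : ℂ)) (-(2 * Real.pi)⁻¹ * y) := by
    funext y
    rw [fourier_eq_integral_expI, symbol]
    congr 1
    funext t
    congr 2
    have := Real.pi_ne_zero
    field_simp
  rw [h]
  have h2 : ContDiff ℝ ((n : ℕ∞) : WithTop ℕ∞)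
      (𝓕 (fun t => (((Ioc 0 1).indicator g t : ℝ) : ℂ))) := by
    refine Real.contDiff_fourier fun k _ => ?_
    have h3 : (fun t : ℝ => ‖t‖ ^ k * ‖(((Ioc 0 1).indicator g t : ℝ) : ℂ)‖) =
        (Ioc 0 1).indicator fun t => ‖t‖ ^ k * ‖g t‖ := by
      funext t
      by_cases ht : t ∈ Ioc (0 : ℝ) 1 <;> simp [ht]
    rw [h3, integrable_indicator_iff measurableSet_Ioc]
    exact Continuous.integrableOn_Ioc (by fun_prop)
  exact h2.comp (by fun_prop)

theorem symbol_box_mul (y : ℝ) : Complex.I * y * symbol box y = expI y - 1 := by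
  rw [box, symbol_indicator, ← intervalIntegral.integral_const_mul]
  rw [intervalIntegral.integral_eq_sub_of_hasDerivAt (f := fun t => expI (y * t))]
  · simp
  · intro t _
    exact (hasDerivAt_expI_mul y t).congr_deriv (by simp)
  · exact Continuous.intervalIntegrable (by fun_prop) _ _

/-- Integration by parts: t - 1 vanishes at 1, and its value at 0 contributes the constant 1. -/
theorem symbol_ramp_mul (y : ℝ) : Complex.I * y * symbol ramp y = 1 - symbol box y := by
  have h1 : ∫ t in (0 : ℝ)..1, (expI (y * t) + ((t - 1 : ℝ) : ℂ) * (Complex.I * y * expI (y * t)))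
      = 1 := by
    rw [intervalIntegral.integral_eq_sub_of_hasDerivAt
      (f := fun t : ℝ => ((t - 1 : ℝ) : ℂ) * expI (y * t))]
    · simp
    · intro t _
      have h := (((hasDerivAt_id t).sub_const 1).ofReal_comp).mul (hasDerivAt_expI_mul y t)
      exact HasDerivAt.congr_deriv (f := fun t : ℝ => ((t - 1 : ℝ) : ℂ) * expI (y * t)) h
        (by simp)
    · exact Continuous.intervalIntegrable (by fun_prop) _ _
  rw [intervalIntegral.integral_add (Continuous.intervalIntegrable (by fun_prop) _ _)
    (Continuous.intervalIntegrable (by fun_prop) _ _)] at h1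
  rw [ramp, box, symbol_indicator, symbol_indicator, ← intervalIntegral.integral_const_mul,
    ← h1]
  rw [eq_sub_iff_add_eq, add_comm]
  congr 1
  · simp
  · congr 1
    funext t; ring

theorem I_mul_ne_expI_sub_one {y : ℝ} (hy : y ≠ 0) : Complex.I * y ≠ expI y - 1 := by
  intro h
  have h1 := congrArg Complex.im h
  simp [expI_im] at h1
  rcases lt_or_gt_of_ne hy with h2 | h2
  · have := Real.sin_lt (x := -y) (by linarith)
    rw [Real.sin_neg] at this
    linarith
  · have := Real.sin_lt h2
    linarith

/-- At 0 the value is -1/2. A zero at y ≠ 0 would give b(y) = 1, that is iy = e^{iy} - 1, whose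
imaginary part y = sin y is impossible. -/
theorem symbol_ramp_ne_zero (y : ℝ) : symbol ramp y ≠ 0 := by
  rcases eq_or_ne y 0 with rfl | hy
  · rw [ramp, symbol_indicator]
    have : ∫ t in (0 : ℝ)..1, ((t - 1 : ℝ) : ℂ) * expI (0 * t) =
        ((∫ t in (0 : ℝ)..1, (t - 1) : ℝ) : ℂ) := by
      rw [← intervalIntegral.integral_ofReal]
      simp
    rw [this]
    norm_num
  · intro h
    have h1 := symbol_ramp_mul y
    have h2 := symbol_box_mul y
    rw [h, mul_zero, eq_comm, sub_eq_zero] at h1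
    rw [← h1, mul_one] at h2
    exact I_mul_ne_expI_sub_one hy h2

theorem steklov_eq_conv {v : ℝ} (hv : v ≠ 0) (f : ℝ → ℝ) : steklov v f = conv box v f := by
  funext x
  have h := intervalIntegral.integral_comp_add_mul (a := 0) (b := 1) f hv x
  rw [mul_zero, add_zero, mul_one, smul_eq_mul] at h
  rw [steklov, ← h, intervalIntegral.integral_of_le zero_le_one,
    ← integral_indicator measurableSet_Ioc, conv]
  congr 1
  funext t
  by_cases ht : t ∈ Ioc (0 : ℝ) 1 <;> simp [box, ht]

/-! ### The two multipliers -/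

/-- A cutoff equal to 1 on [-1, 1] makes the smooth function 1/s compactly supported. The
frequencies k/n of a polynomial of degree n never leave that interval. -/
theorem exists_inverse_ramp_kernel :
    ∃ A R, IsKernel A R ∧ ∀ y, |y| ≤ 1 → symbol R y * symbol ramp y = 1 := by
  let χ : ContDiffBump (0 : ℝ) := ⟨1, 2, one_pos, one_lt_two⟩
  have hs : ContDiff ℝ 2 (symbol ramp) := contDiff_symbol_indicator (n := 2) (by fun_prop)
  have hχ : ContDiff ℝ 2 (fun y => ((χ y : ℝ) : ℂ)) := Complex.ofRealCLM.contDiff.comp χ.contDiff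
  obtain ⟨A, R, hR, hsymb⟩ := exists_kernel_of_hasCompactSupport
    (m := fun y => ((χ y : ℝ) : ℂ) * (symbol ramp y)⁻¹)
    (hχ.mul (hs.inv symbol_ramp_ne_zero)) (fun y => by
      rw [symbol_neg, χ.neg, map_mul, map_inv₀, Complex.conj_ofReal])
    ((χ.hasCompactSupport.comp_left Complex.ofReal_zero).mul_right)
  refine ⟨A, R, hR, fun y hy => ?_⟩
  have h1 : χ y = 1 := χ.one_of_mem_closedBall (by simpa using hy)
  rw [hsymb, h1, Complex.ofReal_one, one_mul, inv_mul_cancel₀ (symbol_ramp_ne_zero y)]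

/-- The reciprocal of `iy`. -/
noncomputable def recip (y : ℝ) : ℂ := (Complex.I * y)⁻¹

/-- The reciprocal of `iy + 1 - e^{iy}`. -/
noncomputable def recipShift (y : ℝ) : ℂ := (Complex.I * y + 1 - expI y)⁻¹

theorem norm_recip (y : ℝ) : ‖recip y‖ = |y|⁻¹ := by
  simp [recip]

/-- The threshold 4 is where |e^{iy} - 1| ≤ 2 is at most half of |y|. -/
theorem norm_recipShift_le {y : ℝ} (hy : 4 ≤ |y|) : ‖recipShift y‖ ≤ 2 * |y|⁻¹ := by
  have h1 : |y| / 2 ≤ ‖Complex.I * y + 1 - expI y‖ := by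
    have h2 : ‖Complex.I * (y : ℂ)‖ ≤ ‖Complex.I * y + 1 - expI y‖ + ‖expI y - 1‖ := by
      refine le_trans (le_of_eq ?_) (norm_add_le _ _)
      congr 1; ring
    have h3 : ‖expI y - 1‖ ≤ 2 := by
      refine (norm_sub_le _ _).trans ?_
      simp; norm_num
    simp only [norm_mul, Complex.norm_I, one_mul, Complex.norm_real, Real.norm_eq_abs] at h2
    linarith
  rw [recipShift, norm_inv]
  refine (inv_anti₀ (by linarith) h1).trans (le_of_eq ?_)
  rw [inv_div]; ring

theorem hasDerivAt_recip {y : ℝ} (hy : y ≠ 0) :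
    HasDerivAt recip (-Complex.I * recip y ^ 2) y := by
  have hne : Complex.I * (y : ℂ) ≠ 0 := by simp [hy]
  have h := (((hasDerivAt_id y).ofReal_comp).const_mul Complex.I).inv hne
  refine HasDerivAt.congr_deriv (f := recip) h ?_
  simp only [recip, id, Complex.ofReal_one]
  field_simp

theorem hasDerivAt_recipShift {y : ℝ} (hy : y ≠ 0) :
    HasDerivAt recipShift (-Complex.I * (1 - expI y) * recipShift y ^ 2) y := by
  have hne : Complex.I * (y : ℂ) + 1 - expI y ≠ 0 := by
    intro h
    refine I_mul_ne_expI_sub_one hy ?_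
    linear_combination h
  have h := (((((hasDerivAt_id y).ofReal_comp).const_mul Complex.I).add_const 1).sub
    (hasDerivAt_expI y)).inv hne
  refine HasDerivAt.congr_deriv (f := recipShift) h ?_
  simp only [recipShift, id, Complex.ofReal_one, Pi.sub_apply]
  field_simp

/-- Products of `recip`, `recipShift` and a polynomial in `expI`, `recip`, `recipShift` are stable
under differentiation, so derivatives keep the y^{-2} decay. -/
theorem hasDerivAt_recip_mul {g : ℝ → ℂ} {g' : ℂ} {y : ℝ} (hy : y ≠ 0) (hg : HasDerivAt g g' y) :
    HasDerivAt (fun y => recip y * recipShift y * g y)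
      (recip y * recipShift y * (g' - Complex.I * g y * recip y -
        Complex.I * (1 - expI y) * g y * recipShift y)) y := by
  refine (((hasDerivAt_recip hy).mul (hasDerivAt_recipShift hy)).mul hg).congr_deriv ?_
  simp only [Pi.mul_apply]
  ring

/-- The arguments of G stay in the closed unit ball, so G is bounded there; the two prefactors
supply the decay. -/
theorem exists_norm_recip_mul_le {G : ℂ × ℂ × ℂ → ℂ} (hG : Continuous G) :
    ∃ C : ℝ, ∀ y : ℝ, 4 ≤ |y| →
      ‖recip y * recipShift y * G (expI y, recip y, recipShift y)‖ ≤ C * (1 + y ^ 2)⁻¹ := by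
  obtain ⟨C, hC⟩ := (isCompact_closedBall (0 : ℂ × ℂ × ℂ) 1).exists_bound_of_continuousOn
    hG.continuousOn
  refine ⟨4 * C, fun y hy => ?_⟩
  have hy0 : 0 < |y| := by linarith
  have h1 : |y|⁻¹ ≤ 4⁻¹ := inv_anti₀ (by norm_num) hy
  have h2 : ‖G (expI y, recip y, recipShift y)‖ ≤ C := by
    apply hC
    rw [mem_closedBall_zero_iff, Prod.norm_def, Prod.norm_def]
    simp only [norm_expI, norm_recip, max_le_iff, le_refl, true_and]
    refine ⟨by linarith, (norm_recipShift_le hy).trans (by linarith)⟩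
  have hC0 : 0 ≤ C := (norm_nonneg _).trans h2
  rw [norm_mul, norm_mul, norm_recip]
  calc |y|⁻¹ * ‖recipShift y‖ * ‖G (expI y, recip y, recipShift y)‖
      ≤ |y|⁻¹ * (2 * |y|⁻¹) * C := by
        gcongr
        exact norm_recipShift_le hy
    _ = 2 * C * (y ^ 2)⁻¹ := by
        rw [← sq_abs]
        field_simp
    _ ≤ 2 * C * (2 * (1 + y ^ 2)⁻¹) := by
        gcongr
        rw [← sq_abs y, ← one_div, ← one_div, mul_one_div, div_le_div_iff₀ (by positivity)
          (by positivity)]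
        nlinarith
    _ = _ := by ring

/-- The regular part of the multiplier `1 / (1 - e)`, with the low frequencies cut off by `χ`. -/
noncomputable def jacksonMultiplier (χ : ContDiffBump (0 : ℝ)) (y : ℝ) : ℂ :=
  -(1 + symbol box y) + (1 - (χ y : ℂ)) / (Complex.I * y * symbol ramp y)

theorem contDiff_jacksonMultiplier (χ : ContDiffBump (0 : ℝ)) :
    ContDiff ℝ 2 (jacksonMultiplier χ) := by
  have hs : ContDiff ℝ 2 (symbol ramp) := contDiff_symbol_indicator (n := 2) (by fun_prop)
  have hb : ContDiff ℝ 2 (symbol box) := contDiff_symbol_indicator (n := 2) (by fun_prop)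
  have hχ : ContDiff ℝ 2 (fun y => ((χ y : ℝ) : ℂ)) := Complex.ofRealCLM.contDiff.comp χ.contDiff
  refine (contDiff_const.add hb).neg.add ?_
  rw [contDiff_iff_contDiffAt]
  intro y
  rcases eq_or_ne y 0 with rfl | hy
  -- The cutoff equals 1 near 0, so the apparent singularity of the quotient is absent.
  · have h0 : (fun y : ℝ => (1 - ((χ y : ℝ) : ℂ)) / (Complex.I * y * symbol ramp y)) =ᶠ[nhds 0]
        fun _ => 0 := by
      filter_upwards [χ.eventuallyEq_one] with y hy
      simp only [Pi.one_apply] at hy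
      simp [hy]
    exact contDiffAt_const.congr_of_eventuallyEq h0
  · have hd : ContDiff ℝ 2 (fun y : ℝ => Complex.I * (y : ℂ) * symbol ramp y) :=
      (contDiff_const.mul Complex.ofRealCLM.contDiff).mul hs
    refine ((contDiff_const.sub hχ).contDiffAt).mul (hd.contDiffAt.inv ?_)
    simp [hy, symbol_ramp_ne_zero]

theorem jacksonMultiplier_neg (χ : ContDiffBump (0 : ℝ)) (y : ℝ) :
    jacksonMultiplier χ (-y) = starRingEnd ℂ (jacksonMultiplier χ y) := by
  simp only [jacksonMultiplier, symbol_neg, χ.neg, map_add, map_neg, map_one, map_div₀, map_sub,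
    map_mul, Complex.conj_I, Complex.conj_ofReal, Complex.ofReal_neg]
  ring

theorem jacksonMultiplier_mul (χ : ContDiffBump (0 : ℝ)) (y : ℝ) :
    (1 + symbol box y + jacksonMultiplier χ y) * (1 - symbol box y) = 1 - (χ y : ℂ) := by
  rw [jacksonMultiplier, ← symbol_ramp_mul]
  rcases eq_or_ne y 0 with rfl | hy
  · simp [χ.eventuallyEq_one.eq_of_nhds]
  · have : (y : ℂ) ≠ 0 := by exact_mod_cast hy
    have := symbol_ramp_ne_zero y
    have := Complex.I_ne_zero
    field_simp
    ring

/-- Beyond the cutoff the multiplier is 1/(1-b) - 1 - b = b²/(1-b) with b = (e^{iy} - 1)/(iy).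
Removing 1 and b, which correspond to the identity and the Steklov mean, is what leaves a term of
order y^{-2}. -/
theorem jacksonMultiplier_of_ge {χ : ContDiffBump (0 : ℝ)} {y : ℝ} (h0 : y ≠ 0)
    (hy : χ.rOut ≤ |y|) :
    jacksonMultiplier χ y = recip y * recipShift y * (expI y - 1) ^ 2 := by
  have h1 : χ y = 0 := χ.zero_of_le_dist (by simpa using hy)
  have hy0 : (y : ℂ) ≠ 0 := by exact_mod_cast h0
  have h2 : symbol box y = (expI y - 1) * recip y := by
    rw [← symbol_box_mul, recip, mul_comm, ← mul_assoc, inv_mul_cancel₀ (by simp [h0]), one_mul]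
  have hne : Complex.I * (y : ℂ) + 1 - expI y ≠ 0 := by
    intro h
    refine I_mul_ne_expI_sub_one h0 ?_
    linear_combination h
  rw [jacksonMultiplier, h1, symbol_ramp_mul, h2, recipShift, recip]
  have h3 : 1 - (expI y - 1) * (Complex.I * (y : ℂ))⁻¹ =
      (Complex.I * y + 1 - expI y) * (Complex.I * (y : ℂ))⁻¹ := by
    have := Complex.I_ne_zero
    field_simp
    ring
  rw [h3]
  have := Complex.I_ne_zero
  simp only [Complex.ofReal_zero, sub_zero]
  field_simp
  ring

theorem exists_jackson_kernel (χ : ContDiffBump (0 : ℝ)) :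
    ∃ A W, IsKernel A W ∧ ∀ y, symbol W y = jacksonMultiplier χ y := by
  have hm := contDiff_jacksonMultiplier χ
  have hm1 : ContDiff ℝ 1 (deriv (jacksonMultiplier χ)) := by
    have : ContDiff ℝ (1 + 1) (jacksonMultiplier χ) := by simpa [one_add_one_eq_two] using hm
    exact (contDiff_succ_iff_deriv.1 this).2.2
  -- The added 1 makes the inequalities strict, so the closed formula holds on a neighbourhood and
  -- may be differentiated.
  set N := max 4 χ.rOut + 1
  have hN (y : ℝ) (hy : N ≤ |y|) : 4 ≤ |y| ∧ χ.rOut ≤ |y| ∧ y ≠ 0 ∧ max 4 χ.rOut < |y| := by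
    have h1 := le_max_left 4 χ.rOut
    have h2 := le_max_right 4 χ.rOut
    have h3 : max 4 χ.rOut < |y| := by linarith
    refine ⟨by linarith, by linarith, ?_, h3⟩
    rintro rfl
    rw [abs_zero] at h3
    linarith
  have hloc {y : ℝ} (hy : max 4 χ.rOut < |y|) : ∀ᶠ z in nhds y, max 4 χ.rOut < |z| :=
    continuous_abs.continuousAt.eventually_const_lt hy
  have hne {y : ℝ} (hy : max 4 χ.rOut < |y|) : y ≠ 0 := by
    rintro rfl
    rw [abs_zero] at hy
    linarith [le_max_left 4 χ.rOut]
  let g0 : ℝ → ℂ := fun y => (expI y - 1) ^ 2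
  let g0' : ℝ → ℂ := fun y => 2 * (expI y - 1) * (Complex.I * expI y)
  let g1 : ℝ → ℂ := fun y => g0' y - Complex.I * g0 y * recip y -
        Complex.I * (1 - expI y) * g0 y * recipShift y
  have hg0 (y : ℝ) : HasDerivAt g0 (g0' y) y := by
    refine (((hasDerivAt_expI y).sub_const 1).pow 2).congr_deriv ?_
    simp [g0']
  have e0 {y : ℝ} (hy : max 4 χ.rOut < |y|) :
      jacksonMultiplier χ y = recip y * recipShift y * g0 y :=
    jacksonMultiplier_of_ge (hne hy) ((le_max_right _ _).trans hy.le)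
  have e1 {y : ℝ} (hy : max 4 χ.rOut < |y|) :
      deriv (jacksonMultiplier χ) y = recip y * recipShift y * g1 y := by
    have h : jacksonMultiplier χ =ᶠ[nhds y] fun y => recip y * recipShift y * g0 y := by
      filter_upwards [hloc hy] with z hz using e0 hz
    rw [h.deriv_eq]
    exact (hasDerivAt_recip_mul (hne hy) (hg0 y)).deriv
  have hg0' (y : ℝ) : HasDerivAt g0' (2 * (Complex.I * expI y) * (Complex.I * expI y) +
      2 * (expI y - 1) * (Complex.I * (Complex.I * expI y))) y :=
    (((hasDerivAt_expI y).sub_const 1).const_mul 2).mul ((hasDerivAt_expI y).const_mul Complex.I)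
  have hg1 {y : ℝ} (hy : y ≠ 0) := ((hg0' y).sub
    (((hg0 y).const_mul Complex.I).mul (hasDerivAt_recip hy))).sub
    (((((hasDerivAt_expI y).const_sub 1).const_mul Complex.I).mul (hg0 y)).mul
      (hasDerivAt_recipShift hy))
  obtain ⟨C0, hC0⟩ := exists_norm_recip_mul_le (G := fun z => (z.1 - 1) ^ 2) (by fun_prop)
  obtain ⟨C1, hC1⟩ := exists_norm_recip_mul_le (G := fun z =>
    2 * (z.1 - 1) * (Complex.I * z.1) - Complex.I * (z.1 - 1) ^ 2 * z.2.1 -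
        Complex.I * (1 - z.1) * (z.1 - 1) ^ 2 * z.2.2) (by fun_prop)
  -- Only the continuity of G matters; the expression is the product rule applied once more to `g1`.
  have hder2 : ∃ G : ℂ × ℂ × ℂ → ℂ, Continuous G ∧ ∀ y : ℝ, max 4 χ.rOut < |y| →
      deriv (deriv (jacksonMultiplier χ)) y =
        recip y * recipShift y * G (expI y, recip y, recipShift y) := by
    refine ⟨fun z => (2 * (Complex.I * z.1) * (Complex.I * z.1) +
      2 * (z.1 - 1) * (Complex.I * (Complex.I * z.1)) -
      (Complex.I * (2 * (z.1 - 1) * (Complex.I * z.1)) * z.2.1 +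
        Complex.I * (z.1 - 1) ^ 2 * (-Complex.I * z.2.1 ^ 2)) -
      ((Complex.I * (-(Complex.I * z.1)) * (z.1 - 1) ^ 2 + Complex.I * (1 - z.1) *
        (2 * (z.1 - 1) * (Complex.I * z.1))) * z.2.2 + Complex.I * (1 - z.1) * (z.1 - 1) ^ 2 *
          (-Complex.I * (1 - z.1) * z.2.2 ^ 2))) -
      Complex.I * (2 * (z.1 - 1) * (Complex.I * z.1) - Complex.I * (z.1 - 1) ^ 2 * z.2.1 -
        Complex.I * (1 - z.1) * (z.1 - 1) ^ 2 * z.2.2) * z.2.1 -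
      Complex.I * (1 - z.1) * (2 * (z.1 - 1) * (Complex.I * z.1) -
        Complex.I * (z.1 - 1) ^ 2 * z.2.1 -
        Complex.I * (1 - z.1) * (z.1 - 1) ^ 2 * z.2.2) * z.2.2, by fun_prop, fun y hy => ?_⟩
    have h : deriv (jacksonMultiplier χ) =ᶠ[nhds y] fun y => recip y * recipShift y * g1 y := by
      filter_upwards [hloc hy] with z hz using e1 hz
    rw [h.deriv_eq]
    exact (hasDerivAt_recip_mul (hne hy) (hg1 (hne hy))).deriv
  obtain ⟨G2, hG2, e2⟩ := hder2
  obtain ⟨C2, hC2⟩ := exists_norm_recip_mul_le hG2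
  refine exists_kernel_of_integrable_deriv hm (jacksonMultiplier_neg χ)
    (integrable_of_norm_le_of_le hm.continuous (C := C0) (N := N) fun y hy => ?_)
    (integrable_of_norm_le_of_le hm1.continuous (C := C1) (N := N) fun y hy => ?_)
    (integrable_of_norm_le_of_le (hm1.continuous_deriv le_rfl) (C := C2) (N := N) fun y hy => ?_)
  · rw [e0 (hN y hy).2.2.2]
    exact hC0 y (hN y hy).1
  · rw [e1 (hN y hy).2.2.2]
    exact hC1 y (hN y hy).1
  · rw [e2 y (hN y hy).2.2.2]
    exact hC2 y (hN y hy).1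

/-! ### Integrable functions on the circle -/

/-- The locally integrable `2π`-periodic functions. -/
structure IsCircle (f : ℝ → ℝ) : Prop where
  periodic : Function.Periodic f (2 * Real.pi)
  aestronglyMeasurable : AEStronglyMeasurable f volume
  integrableOn : IntegrableOn f (Ioc (-Real.pi) Real.pi)

namespace IsCircle

variable {f g : ℝ → ℝ}

theorem add (hf : IsCircle f) (hg : IsCircle g) : IsCircle (fun x => f x + g x) :=
  ⟨fun x => by simp only [hf.periodic x, hg.periodic x],
    hf.aestronglyMeasurable.add hg.aestronglyMeasurable, hf.integrableOn.add hg.integrableOn⟩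

theorem sub (hf : IsCircle f) (hg : IsCircle g) : IsCircle (fun x => f x - g x) :=
  ⟨fun x => by simp only [hf.periodic x, hg.periodic x],
    hf.aestronglyMeasurable.sub hg.aestronglyMeasurable, hf.integrableOn.sub hg.integrableOn⟩

theorem conv (hf : IsCircle f) {A : ℝ} {R : ℝ → ℝ} (hR : IsKernel A R) (v : ℝ) :
    IsCircle (conv R v f) :=
  ⟨conv_periodic R v hf.periodic, aestronglyMeasurable_conv hR.measurable v hf.aestronglyMeasurable,
    integrableOn_conv hR.integrable hf.periodic hf.aestronglyMeasurable hf.integrableOn v⟩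

theorem iterate {Φ : (ℝ → ℝ) → ℝ → ℝ} (hΦ : ∀ f, IsCircle f → IsCircle (Φ f)) (hf : IsCircle f)
    (r : ℕ) : IsCircle (Φ^[r] f) := by
  induction r with
  | zero => exact hf
  | succ r ih => rw [Function.iterate_succ_apply']; exact hΦ _ ih

theorem steklovDiff (hf : IsCircle f) {v : ℝ} (hv : v ≠ 0) : IsCircle (steklovDiff v f) := by
  have h := hf.sub (hf.conv isKernel_box v)
  rwa [← steklov_eq_conv hv] at h

theorem intervalIntegrable (hf : IsCircle f) (a b : ℝ) : IntervalIntegrable f volume a b := by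
  refine hf.periodic.intervalIntegrable Real.two_pi_pos.ne' (t := -Real.pi) ?_ a b
  rw [show -Real.pi + 2 * Real.pi = Real.pi by ring,
    intervalIntegrable_iff_integrableOn_Ioc_of_le (by linarith [Real.pi_pos])]
  exact hf.integrableOn

theorem steklovDiff_add (hf : IsCircle f) (hg : IsCircle g) (v : ℝ) :
    WeightedTrig.steklovDiff v (fun x => f x + g x) =
      fun x => WeightedTrig.steklovDiff v f x + WeightedTrig.steklovDiff v g x := by
  funext x
  simp only [WeightedTrig.steklovDiff, steklov]
  rw [intervalIntegral.integral_add (hf.intervalIntegrable _ _) (hg.intervalIntegrable _ _)]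
  ring

theorem iterate_steklovDiff_add (hf : IsCircle f) (hg : IsCircle g) {v : ℝ} (hv : v ≠ 0) (r : ℕ) :
    (WeightedTrig.steklovDiff v)^[r] (fun x => f x + g x) =
      fun x => (WeightedTrig.steklovDiff v)^[r] f x + (WeightedTrig.steklovDiff v)^[r] g x := by
  induction r with
  | zero => rfl
  | succ r ih =>
    simp only [Function.iterate_succ_apply', ih]
    exact steklovDiff_add (hf.iterate (fun f hf => hf.steklovDiff hv) r)
      (hg.iterate (fun f hf => hf.steklovDiff hv) r) v

theorem integrableOn_ofReal (hf : IsCircle f) :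
    IntegrableOn (fun x => (f x : ℂ)) (Ioc (-Real.pi) Real.pi) :=
  hf.integrableOn.ofReal

theorem coeff_conv (hf : IsCircle f) {A : ℝ} {R : ℝ → ℝ} (hR : IsKernel A R) (v : ℝ) (k : ℤ) :
    coeff (fun x => (WeightedTrig.conv R v f x : ℂ)) k =
      symbol R (k * v) * coeff (fun x => (f x : ℂ)) k :=
  WeightedTrig.coeff_conv hR.integrable hf.periodic hf.aestronglyMeasurable hf.integrableOn v k

theorem coeff_steklovDiff (hf : IsCircle f) {v : ℝ} (hv : v ≠ 0) (k : ℤ) :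
    coeff (fun x => (WeightedTrig.steklovDiff v f x : ℂ)) k =
      (1 - symbol box (k * v)) * coeff (fun x => (f x : ℂ)) k := by
  simp only [WeightedTrig.steklovDiff, steklov_eq_conv hv, Complex.ofReal_sub]
  rw [coeff_sub hf.integrableOn_ofReal (hf.conv isKernel_box v).integrableOn_ofReal,
    hf.coeff_conv isKernel_box]
  ring

theorem coeff_iterate {Φ : (ℝ → ℝ) → ℝ → ℝ} (hΦ : ∀ f, IsCircle f → IsCircle (Φ f)) {k : ℤ} {c : ℂ}
    (hc : ∀ f, IsCircle f → coeff (fun x => (Φ f x : ℂ)) k = c * coeff (fun x => (f x : ℂ)) k)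
    (hf : IsCircle f) (r : ℕ) :
    coeff (fun x => (Φ^[r] f x : ℂ)) k = c ^ r * coeff (fun x => (f x : ℂ)) k := by
  induction r with
  | zero => simp
  | succ r ih =>
    simp only [Function.iterate_succ_apply']
    rw [hc _ (hf.iterate hΦ r), ih, pow_succ]
    ring

end IsCircle

theorem wNorm_iterate_le {p : ℝ≥0∞} {γ : ℝ → ℝ≥0∞} {Φ : (ℝ → ℝ) → ℝ → ℝ} {C : ℝ≥0}
    (hΦ : ∀ f, IsCircle f → IsCircle (Φ f))
    (hC : ∀ f, IsCircle f → wNorm p γ (Φ f) ≤ C * wNorm p γ f) {f : ℝ → ℝ} (hf : IsCircle f)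
    (r : ℕ) : wNorm p γ (Φ^[r] f) ≤ (C ^ r : ℝ≥0) * wNorm p γ f := by
  induction r with
  | zero => simp
  | succ r ih =>
    rw [Function.iterate_succ_apply']
    calc wNorm p γ (Φ (Φ^[r] f)) ≤ C * wNorm p γ (Φ^[r] f) := hC _ (hf.iterate hΦ r)
      _ ≤ C * ((C ^ r : ℝ≥0) * wNorm p γ f) := by gcongr
      _ = _ := by push_cast; ring

/-! ### Norm bounds for the Steklov difference and the Jackson operator -/

section Bounds

variable {p : ℝ≥0∞} {γ : ℝ → ℝ≥0∞} {B : ℝ≥0}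

theorem ConvBound.wNorm_conv_le (hB : ConvBound p γ B) {A : ℝ} {R : ℝ → ℝ} (hR : IsKernel A R)
    {v : ℝ} (hv : 0 < v) {f : ℝ → ℝ} (hf : IsCircle f) :
    wNorm p γ (conv R v f) ≤ (B * A.toNNReal : ℝ≥0) * wNorm p γ f := by
  push_cast
  exact hB A R hR v hv f hf.periodic hf.aestronglyMeasurable

theorem ConvBound.wNorm_steklovDiff_le (hp : 1 ≤ p) (hB : ConvBound p γ B) {v : ℝ} (hv : 0 < v)
    {f : ℝ → ℝ} (hf : IsCircle f) :
    wNorm p γ (steklovDiff v f) ≤ (1 + B * 2 : ℝ≥0) * wNorm p γ f := by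
  have h1 := hB.wNorm_conv_le isKernel_box hv hf
  rw [← steklov_eq_conv hv.ne'] at h1
  have h2 := hf.conv isKernel_box v
  rw [← steklov_eq_conv hv.ne'] at h2
  refine (wNorm_sub_le hp hf.aestronglyMeasurable h2.aestronglyMeasurable).trans ?_
  simp only [Real.toNNReal_ofNat] at h1
  refine (add_le_add_right h1 _).trans (le_of_eq ?_)
  push_cast; ring

/-- Applied to `(I - T_v) f`, this operator gives `f` up to low frequencies. -/
noncomputable def jacksonOp (W : ℝ → ℝ) (v : ℝ) (f : ℝ → ℝ) : ℝ → ℝ :=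
  fun x => f x + conv box v f x + conv W v f x

theorem isCircle_jacksonOp {A : ℝ} {W : ℝ → ℝ} (hW : IsKernel A W) (v : ℝ) {f : ℝ → ℝ}
    (hf : IsCircle f) : IsCircle (jacksonOp W v f) :=
  (hf.add (hf.conv isKernel_box v)).add (hf.conv hW v)

theorem coeff_jacksonOp {A : ℝ} {W : ℝ → ℝ} (hW : IsKernel A W) (v : ℝ) {f : ℝ → ℝ}
    (hf : IsCircle f) (k : ℤ) : coeff (fun x => (jacksonOp W v f x : ℂ)) k =
      (1 + symbol box (k * v) + symbol W (k * v)) * coeff (fun x => (f x : ℂ)) k := by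
  have h1 := hf.conv isKernel_box v
  have h2 := hf.conv hW v
  simp only [jacksonOp, Complex.ofReal_add]
  rw [coeff_add (f := fun x => (f x : ℂ) + (conv box v f x : ℂ))
      (hf.integrableOn_ofReal.add h1.integrableOn_ofReal) h2.integrableOn_ofReal,
    coeff_add hf.integrableOn_ofReal h1.integrableOn_ofReal, hf.coeff_conv isKernel_box,
    hf.coeff_conv hW]
  ring

theorem ConvBound.wNorm_jacksonOp_le (hp : 1 ≤ p) (hB : ConvBound p γ B) {A : ℝ} {W : ℝ → ℝ}
    (hW : IsKernel A W) {v : ℝ} (hv : 0 < v) {f : ℝ → ℝ} (hf : IsCircle f) :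
    wNorm p γ (jacksonOp W v f) ≤ (1 + B * 2 + B * A.toNNReal : ℝ≥0) * wNorm p γ f := by
  have h1 := hf.conv isKernel_box v
  have h2 := hf.conv hW v
  have e1 := hB.wNorm_conv_le isKernel_box hv hf
  have e2 := hB.wNorm_conv_le hW hv hf
  simp only [Real.toNNReal_ofNat] at e1
  calc wNorm p γ (jacksonOp W v f)
      ≤ wNorm p γ (fun x => f x + WeightedTrig.conv box v f x) + wNorm p γ (conv W v f) :=
        wNorm_add_le hp (hf.add h1).aestronglyMeasurable h2.aestronglyMeasurable
    _ ≤ wNorm p γ f + wNorm p γ (conv box v f) + wNorm p γ (conv W v f) := by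
        gcongr
        exact wNorm_add_le hp hf.aestronglyMeasurable h1.aestronglyMeasurable
    _ ≤ wNorm p γ f + (B * 2 : ℝ≥0) * wNorm p γ f + (B * A.toNNReal : ℝ≥0) * wNorm p γ f := by
        gcongr
    _ = _ := by push_cast; ring

end Bounds

/-! ### Trigonometric polynomials -/

/-- The real part of a trigonometric polynomial with nonnegative frequencies. -/
noncomputable def trigRe (n : ℕ) (z : ℕ → ℂ) (x : ℝ) : ℝ :=
  (∑ k ∈ Finset.range (n + 1), z k * expI (k * x)).re

theorem exists_trigRe_of_mem_trigPoly {n : ℕ} {U : ℝ → ℝ} (hU : U ∈ trigPoly n) :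
    ∃ z, U = trigRe n z := by
  obtain ⟨a, b, h⟩ := hU
  refine ⟨fun k => a k - b k * Complex.I, ?_⟩
  funext x
  rw [h, trigRe, Complex.re_sum]
  refine Finset.sum_congr rfl fun k _ => ?_
  simp [expI_re, expI_im]

/-- Frequencies k and -k are merged into |k|; the sign of k accounts for the oddness of the sine. -/
theorem re_sum_expI_mem_trigPoly (n : ℕ) (d : ℤ → ℂ) :
    (fun x => (∑ k ∈ Finset.Icc (-n : ℤ) n, d k * expI (k * x)).re) ∈ trigPoly n := by
  refine ⟨fun m => ∑ k ∈ Finset.Icc (-n : ℤ) n with k.natAbs = m, (d k).re,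
    fun m => ∑ k ∈ Finset.Icc (-n : ℤ) n with k.natAbs = m, -((d k).im * k.sign), fun x => ?_⟩
  simp only
  rw [Complex.re_sum, ← Finset.sum_fiberwise_of_maps_to (t := Finset.range (n + 1))
    (g := Int.natAbs)]
  · refine Finset.sum_congr rfl fun m _ => ?_
    rw [Finset.sum_mul, Finset.sum_mul, ← Finset.sum_add_distrib]
    refine Finset.sum_congr rfl fun k hk => ?_
    obtain rfl := (Finset.mem_filter.1 hk).2
    have h1 : Real.cos (k * x) = Real.cos (k.natAbs * x) := by
      rcases Int.natAbs_eq k with h | h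
      · rw [h]; simp
      · rw [h]; simp
    have h2 : Real.sin (k * x) = k.sign * Real.sin (k.natAbs * x) := by
      rcases lt_trichotomy k 0 with h | h | h
      · have h3 : (k : ℝ) = -(k.natAbs : ℝ) := by
          rw [Nat.cast_natAbs, abs_of_neg h]; simp
        rw [Int.sign_eq_neg_one_of_neg h, h3, neg_mul, Real.sin_neg]; simp
      · simp [h]
      · have h3 : (k : ℝ) = (k.natAbs : ℝ) := by
          rw [Nat.cast_natAbs, abs_of_pos h]
        rw [Int.sign_eq_one_of_pos h, h3]; simp
    rw [Complex.mul_re, expI_re, expI_im, h1, h2]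
    ring
  · intro k hk
    rw [Finset.mem_Icc] at hk
    rw [Finset.mem_range]
    omega

theorem continuous_trigRe (n : ℕ) (z : ℕ → ℂ) : Continuous (trigRe n z) := by
  unfold trigRe
  fun_prop

theorem isCircle_trigRe (n : ℕ) (z : ℕ → ℂ) : IsCircle (trigRe n z) := by
  refine ⟨fun x => ?_, (continuous_trigRe n z).aestronglyMeasurable,
    (continuous_trigRe n z).integrableOn_Ioc⟩
  simp only [trigRe]
  congr 1
  refine Finset.sum_congr rfl fun k _ => ?_
  congr 1
  exact_mod_cast expI_periodic k x

theorem const_mul_trigRe (n : ℕ) (z : ℕ → ℂ) (c : ℝ) :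
    (fun x => c * trigRe n z x) = trigRe n fun k => c * z k := by
  funext x
  rw [trigRe, trigRe, ← Complex.re_ofReal_mul, Finset.mul_sum]
  simp only [mul_assoc]

theorem deriv_trigRe (n : ℕ) (z : ℕ → ℂ) :
    deriv (trigRe n z) = trigRe n fun k => Complex.I * k * z k := by
  funext x
  have h : HasDerivAt (fun x => ∑ k ∈ Finset.range (n + 1), z k * expI (k * x))
      (∑ k ∈ Finset.range (n + 1), z k * (Complex.I * (k : ℝ) * expI (k * x))) x :=
    HasDerivAt.fun_sum fun k _ => (hasDerivAt_expI_mul k x).const_mul (z k)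
  have h2 := (Complex.reCLM.hasFDerivAt.comp_hasDerivAt x h).deriv
  refine Eq.trans h2 ?_
  rw [Complex.reCLM_apply, trigRe]
  congr 1
  refine Finset.sum_congr rfl fun k _ => ?_
  push_cast; ring

theorem iteratedDeriv_trigRe (n : ℕ) (z : ℕ → ℂ) (r : ℕ) :
    iteratedDeriv r (trigRe n z) = trigRe n fun k => (Complex.I * k) ^ r * z k := by
  induction r with
  | zero => simp
  | succ r ih =>
    rw [iteratedDeriv_succ, ih, deriv_trigRe]
    congr 1
    funext k; ring

theorem iterate_trigRe {Φ : (ℝ → ℝ) → ℝ → ℝ} {n : ℕ} {c : ℕ → ℂ}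
    (h : ∀ z, Φ (trigRe n z) = trigRe n fun k => c k * z k) (z : ℕ → ℂ) (r : ℕ) :
    Φ^[r] (trigRe n z) = trigRe n fun k => c k ^ r * z k := by
  induction r with
  | zero => simp
  | succ r ih =>
    rw [Function.iterate_succ_apply', ih, h]
    congr 1
    funext k; ring

theorem conv_trigRe {A : ℝ} {R : ℝ → ℝ} (hR : IsKernel A R) (v : ℝ) (n : ℕ) (z : ℕ → ℂ) :
    conv R v (trigRe n z) = trigRe n fun k => symbol R (k * v) * z k :=
  conv_re_sum hR.integrable v _ z

theorem steklovDiff_trigRe {v : ℝ} (hv : v ≠ 0) (n : ℕ) (z : ℕ → ℂ) :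
    steklovDiff v (trigRe n z) = trigRe n fun k => (1 - symbol box (k * v)) * z k := by
  funext x
  rw [steklovDiff, steklov_eq_conv hv, conv_trigRe isKernel_box]
  simp only [trigRe]
  rw [← Complex.sub_re, ← Finset.sum_sub_distrib]
  congr 1
  refine Finset.sum_congr rfl fun k _ => ?_
  ring

theorem trigRe_congr {n : ℕ} {z w : ℕ → ℂ} (h : ∀ k ≤ n, z k = w k) : trigRe n z = trigRe n w := by
  funext x
  simp only [trigRe]
  congr 1
  refine Finset.sum_congr rfl fun k hk => ?_
  rw [h k (by rw [Finset.mem_range] at hk; omega)]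

/-! ### The direct, inverse and Nikolskii–Stechkin type inequalities -/

section Inequalities

variable {p : ℝ≥0∞} {γ : ℝ → ℝ≥0∞} {B : ℝ≥0}

/-- This is the identity 1 - b(kv) = ikv s(kv), raised to the power r on each frequency. -/
theorem iterate_steklovDiff_trigRe_eq {v : ℝ} (hv : v ≠ 0) (n : ℕ) (z : ℕ → ℂ) (r : ℕ) :
    (steklovDiff v)^[r] (trigRe n z) =
      fun x => v ^ r * (conv ramp v)^[r] (iteratedDeriv r (trigRe n z)) x := by
  rw [iterate_trigRe (steklovDiff_trigRe hv n), iteratedDeriv_trigRe,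
    iterate_trigRe (conv_trigRe isKernel_ramp v n), const_mul_trigRe]
  refine trigRe_congr fun k _ => ?_
  rw [← symbol_ramp_mul]
  push_cast
  ring

theorem iteratedDeriv_trigRe_eq {A : ℝ} {R : ℝ → ℝ} (hR : IsKernel A R)
    (hinv : ∀ y, |y| ≤ 1 → symbol R y * symbol ramp y = 1) {n : ℕ} (hn : 1 ≤ n) (z : ℕ → ℂ)
    (r : ℕ) : iteratedDeriv r (trigRe n z) =
      fun x => (n : ℝ) ^ r * (conv R (1 / n))^[r]
        ((steklovDiff (1 / (n : ℝ)))^[r] (trigRe n z)) x := by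
  have hn0 : (0 : ℝ) < n := by exact_mod_cast hn
  have hn1 : (n : ℂ) ≠ 0 := by exact_mod_cast hn0.ne'
  rw [iterate_trigRe (steklovDiff_trigRe (by positivity) n), iteratedDeriv_trigRe,
    iterate_trigRe (conv_trigRe hR _ n), const_mul_trigRe]
  refine trigRe_congr fun k hk => ?_
  have hk1 : |(k : ℝ) * (1 / n)| ≤ 1 := by
    rw [abs_of_nonneg (by positivity), mul_one_div, div_le_one hn0]
    exact_mod_cast hk
  have h1 := hinv _ hk1
  rw [← symbol_ramp_mul]
  push_cast
  rw [← mul_assoc, ← mul_assoc, ← mul_pow, ← mul_pow]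
  congr 2
  set s := symbol R (k * (1 / n))
  set t := symbol ramp (k * (1 / n))
  calc Complex.I * (k : ℂ) = Complex.I * k * (n * (1 / n)) * 1 := by
        rw [mul_one_div_cancel hn1]; ring
    _ = _ := by rw [← h1]; ring

theorem ConvBound.omega_trigRe_le (hB : ConvBound p γ B) {n : ℕ} (hn : 1 ≤ n) (z : ℕ → ℂ) (r : ℕ) :
    Omega r (trigRe n z) (1 / (n : ℝ)) p γ ≤
      ((B * 2) ^ r : ℝ≥0) * (((n : ℝ≥0∞) ^ r)⁻¹ * wNorm p γ (iteratedDeriv r (trigRe n z))) := by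
  have hn0 : (0 : ℝ) < n := by exact_mod_cast hn
  have hv : (0 : ℝ) < 1 / n := by positivity
  have h := wNorm_iterate_le (p := p) (γ := γ) (Φ := conv ramp (1 / n)) (C := B * 2)
    (fun f hf => hf.conv isKernel_ramp _) (fun f hf => by
      simpa using hB.wNorm_conv_le isKernel_ramp hv hf)
    (f := iteratedDeriv r (trigRe n z)) (by rw [iteratedDeriv_trigRe]; exact isCircle_trigRe _ _) r
  have h2 : ENNReal.ofReal |(1 / (n : ℝ)) ^ r| = ((n : ℝ≥0∞) ^ r)⁻¹ := by
    rw [abs_of_pos (by positivity), one_div, inv_pow, ENNReal.ofReal_inv_of_pos (by positivity),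
      ENNReal.ofReal_pow hn0.le, ENNReal.ofReal_natCast]
  rw [Omega, iterate_steklovDiff_trigRe_eq hv.ne', wNorm_const_mul, h2]
  refine (mul_le_mul_right h _).trans (le_of_eq ?_)
  ring

theorem ConvBound.wNorm_iteratedDeriv_le (hB : ConvBound p γ B) {A : ℝ} {R : ℝ → ℝ}
    (hR : IsKernel A R) (hinv : ∀ y, |y| ≤ 1 → symbol R y * symbol ramp y = 1) {n : ℕ}
    (hn : 1 ≤ n) (z : ℕ → ℂ) (r : ℕ) :
    ((n : ℝ≥0∞) ^ r)⁻¹ * wNorm p γ (iteratedDeriv r (trigRe n z)) ≤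
      ((B * A.toNNReal) ^ r : ℝ≥0) * Omega r (trigRe n z) (1 / (n : ℝ)) p γ := by
  have hn0 : (0 : ℝ) < n := by exact_mod_cast hn
  have hv : (0 : ℝ) < 1 / n := by positivity
  have h := wNorm_iterate_le (p := p) (γ := γ) (Φ := conv R (1 / n)) (C := B * A.toNNReal)
    (fun f hf => hf.conv hR _) (fun f hf => hB.wNorm_conv_le hR hv hf)
    (f := (steklovDiff (1 / (n : ℝ)))^[r] (trigRe n z))
    ((isCircle_trigRe n z).iterate (fun f hf => hf.steklovDiff hv.ne') r) r
  have h2 : ENNReal.ofReal |(n : ℝ) ^ r| = (n : ℝ≥0∞) ^ r := by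
    rw [abs_of_pos (by positivity), ENNReal.ofReal_pow hn0.le, ENNReal.ofReal_natCast]
  have h3 : ((n : ℝ≥0∞) ^ r) ≠ 0 := pow_ne_zero _ (by exact_mod_cast (by omega : n ≠ 0))
  have h4 : ((n : ℝ≥0∞) ^ r) ≠ ∞ := ENNReal.pow_ne_top (ENNReal.natCast_ne_top n)
  rw [iteratedDeriv_trigRe_eq hR hinv hn, wNorm_const_mul, h2, ← mul_assoc,
    ENNReal.inv_mul_cancel h3 h4, one_mul]
  exact h

/-- The r-th power of the Jackson operator, applied to (I - T_v)^r f, gives q with coefficients (1 -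
χ(kv))^r times those of f. As χ(kv) = 0 for |k| ≥ n, f - q is a polynomial of degree at most n, and
‖q‖ is controlled by Ω_r(f, 1/n). -/
theorem ConvBound.bestApprox_le (hp : 1 ≤ p) (hB : ConvBound p γ B) {A : ℝ} {W : ℝ → ℝ}
    (hW : IsKernel A W) {χ : ContDiffBump (0 : ℝ)} (hχ : χ.rOut ≤ 1)
    (hsymb : ∀ y, symbol W y = jacksonMultiplier χ y) {n : ℕ} (hn : 1 ≤ n) {f : ℝ → ℝ}
    (hf : IsCircle f) (r : ℕ) :
    bestApprox n f p γ ≤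
      ((1 + B * 2 + B * A.toNNReal) ^ r : ℝ≥0) * Omega r f (1 / (n : ℝ)) p γ := by
  have hn0 : (0 : ℝ) < n := by exact_mod_cast hn
  have hv : (0 : ℝ) < 1 / n := by positivity
  set v : ℝ := 1 / n with hvdef
  have hΦ : ∀ f, IsCircle f → IsCircle (steklovDiff v f) := fun f hf => hf.steklovDiff hv.ne'
  have hQ : ∀ f, IsCircle f → IsCircle (jacksonOp W v f) := fun f hf => isCircle_jacksonOp hW v hf
  set g := (steklovDiff v)^[r] f with hg
  have hgc : IsCircle g := hf.iterate hΦ r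
  set q := (jacksonOp W v)^[r] g with hq
  have hqc : IsCircle q := hgc.iterate hQ r
  have hqle : wNorm p γ q ≤ ((1 + B * 2 + B * A.toNNReal) ^ r : ℝ≥0) * wNorm p γ g :=
    wNorm_iterate_le hQ (fun f hf => hB.wNorm_jacksonOp_le hp hW hv hf) hgc r
  -- These are the coefficients of f - q; the division by 2π compensates for the unnormalized
  -- `coeff`.
  let d : ℤ → ℂ := fun k => (1 - (1 - (χ (k * v) : ℂ)) ^ r) * coeff (fun x => (f x : ℂ)) k /
    (2 * Real.pi)
  have hcq (k : ℤ) : coeff (fun x => (q x : ℂ)) k =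
      (1 - (χ (k * v) : ℂ)) ^ r * coeff (fun x => (f x : ℂ)) k := by
    rw [hq, IsCircle.coeff_iterate hQ (fun f hf => coeff_jacksonOp hW v hf k) hgc, hg,
      IsCircle.coeff_iterate hΦ (fun f hf => hf.coeff_steklovDiff hv.ne' k) hf,
      ← mul_assoc, ← mul_pow, hsymb, jacksonMultiplier_mul]
  have hsumc : Continuous fun x : ℝ => ∑ k ∈ Finset.Icc (-n : ℤ) n, d k * expI (k * x) := by
    fun_prop
  have hzero : ∀ᵐ x, (f x : ℂ) - q x - ∑ k ∈ Finset.Icc (-n : ℤ) n, d k * expI (k * x) = 0 := by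
    refine ae_eq_zero_of_coeff_eq_zero (fun x => ?_) ?_ fun k => ?_
    · simp only [hf.periodic x, hqc.periodic x]
      congr 1
      refine Finset.sum_congr rfl fun k _ => ?_
      congr 1
      exact expI_periodic k x
    · exact (hf.integrableOn_ofReal.sub hqc.integrableOn_ofReal).sub hsumc.integrableOn_Ioc
    · rw [coeff_sub (f := fun x => (f x : ℂ) - (q x : ℂ))
        (hf.integrableOn_ofReal.sub hqc.integrableOn_ofReal) hsumc.integrableOn_Ioc,
        coeff_sub hf.integrableOn_ofReal hqc.integrableOn_ofReal, coeff_sum_expI, hcq]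
      have hpi : (Real.pi : ℂ) ≠ 0 := by exact_mod_cast Real.pi_ne_zero
      split_ifs with hk
      · simp only [d]
        field_simp
        ring
      · have h1 : χ ((k : ℝ) * v) = 0 := by
          refine χ.zero_of_le_dist (hχ.trans ?_)
          rw [Finset.mem_Icc, not_and_or] at hk
          have h2 : (n : ℤ) ≤ |k| := by
            rcases hk with hk | hk
            · exact le_trans (by omega) (neg_le_abs k)
            · exact le_trans (by omega) (le_abs_self k)
          rw [Real.dist_eq, sub_zero, abs_mul, abs_of_pos hv, hvdef, mul_one_div, le_div_iff₀ hn0,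
            one_mul]
          exact_mod_cast h2
        rw [h1]
        simp
  refine (iInf₂_le _ (re_sum_expI_mem_trigPoly n d)).trans ?_
  -- Since f and q are real, taking real parts turns the exponential sum into a real polynomial
  -- without checking any symmetry of d.
  have hae : (fun x => f x - (∑ k ∈ Finset.Icc (-n : ℤ) n, d k * expI (k * x)).re)
      =ᵐ[volume] q := by
    filter_upwards [hzero] with x hx
    have := congrArg Complex.re hx
    simp only [Complex.sub_re, Complex.ofReal_re, Complex.zero_re] at this
    linarith
  rw [wNorm_congr_ae hae]
  exact hqle

theorem ConvBound.omega_le (hp : 1 ≤ p) (hB : ConvBound p γ B) {v : ℝ} (hv : 0 < v) {f : ℝ → ℝ}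
    (hf : IsCircle f) (r : ℕ) :
    Omega r f v p γ ≤ ((1 + B * 2) ^ r : ℝ≥0) * wNorm p γ f :=
  wNorm_iterate_le (fun _ hf => hf.steklovDiff hv.ne')
    (fun _ hf => hB.wNorm_steklovDiff_le hp hv hf) hf r

theorem omega_add_le (hp : 1 ≤ p) {v : ℝ} (hv : v ≠ 0) {f g : ℝ → ℝ} (hf : IsCircle f)
    (hg : IsCircle g) (r : ℕ) :
    Omega r (fun x => f x + g x) v p γ ≤ Omega r f v p γ + Omega r g v p γ := by
  rw [Omega, hf.iterate_steklovDiff_add hg hv]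
  exact wNorm_add_le hp (hf.iterate (fun f hf => hf.steklovDiff hv) r).aestronglyMeasurable
    (hg.iterate (fun f hf => hf.steklovDiff hv) r).aestronglyMeasurable

end Inequalities

end WeightedTrig

/-! ### Assembly of the two estimates -/

theorem mainTheorem5 (r : ℕ) (hr : 1 ≤ r) (p : ℝ≥0∞) (hp : 1 ≤ p)
    (M : ℝ≥0) (c : ℝ≥0) (hc : 0 < c) (K : ℝ≥0) (hK : 1 ≤ K) :
    ∃ C : ℝ≥0, 0 < C ∧
      ∀ γ : ℝ → ℝ≥0∞, WeightedTrig.MemAS p γ →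
        WeightedTrig.weightConst p γ ≤ M →
        (p = 1 → ∀ᵐ x, (c : ℝ≥0∞) ≤ γ x) →
        ∀ f : ℝ → ℝ, WeightedTrig.MemL p γ f →
        ∀ n : ℕ, 1 ≤ n →
        ∀ U : ℝ → ℝ, WeightedTrig.IsNearBest K n f p γ U →
          WeightedTrig.Omega r f (1 / (n : ℝ)) p γ ≤ C * WeightedTrig.realization r n f U p γ ∧
          WeightedTrig.realization r n f U p γ ≤ C * WeightedTrig.Omega r f (1 / (n : ℝ)) p γ := by
  open WeightedTrig in
  obtain ⟨B, hB⟩ := exists_convBound hp M hc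
  obtain ⟨A₁, R, hR, hinv⟩ := exists_inverse_ramp_kernel
  -- Outer radius 1 is what confines χ(k/n) to frequencies |k| < n.
  let χ : ContDiffBump (0 : ℝ) := ⟨1 / 2, 1, by norm_num, by norm_num⟩
  obtain ⟨A₂, W, hW, hsymb⟩ := exists_jackson_kernel χ
  set D₁ : ℝ≥0 := (1 + B * 2) ^ r
  set D₂ : ℝ≥0 := (B * 2) ^ r
  set D₃ : ℝ≥0 := (B * A₁.toNNReal) ^ r
  set D₄ : ℝ≥0 := (1 + B * 2 + B * A₂.toNNReal) ^ r
  -- The sum of the constants of the two directions; the 1 only ensures positivity.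
  refine ⟨1 + D₁ + D₂ + (K * D₄ + D₃ * (1 + D₁ * (K * D₄))), by positivity, ?_⟩
  intro γ hγ hM hγc f hf n hn U hU
  replace hB := hB γ hγ hM hγc
  have hfc : IsCircle f := ⟨hf.1, hf.aestronglyMeasurable (hγ.isWeight hp), hf.integrableOn hp hγ⟩
  obtain ⟨z, rfl⟩ := exists_trigRe_of_mem_trigPoly hU.1
  have hUc := isCircle_trigRe n z
  have hn0 : (0 : ℝ) < n := by exact_mod_cast hn
  have hv : (0 : ℝ) < 1 / n := by positivity
  have hdiff := hfc.sub hUc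
  have hΩ := hB.omega_le hp hv hdiff r
  -- Subadditivity of Ω_r is available for sums, so U is written as (U - f) + f to bound Ω_r(U) by
  -- Ω_r(f).
  have hneg : IsCircle fun x => trigRe n z x - f x := hUc.sub hfc
  have hΩ' := hB.omega_le hp hv hneg r
  have hsymm : wNorm p γ (fun x => trigRe n z x - f x) = wNorm p γ (fun x => f x - trigRe n z x) :=
    eLpNorm_sub_comm _ _ _ _
  rw [hsymm] at hΩ'
  have h1 := omega_add_le (γ := γ) hp hv.ne' hdiff hUc r
  have h2 := omega_add_le (γ := γ) hp hv.ne' hneg hfc r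
  simp only [sub_add_cancel] at h1 h2
  have h3 := hB.omega_trigRe_le hn z r
  have h4 := hB.wNorm_iteratedDeriv_le hR hinv hn z r
  have h5 := hU.2.trans (mul_le_mul_right (hB.bestApprox_le hp hW le_rfl hsymb hn hfc r) _)
  simp only [realization]
  set a := wNorm p γ (fun x => f x - trigRe n z x)
  set b := ((n : ℝ≥0∞) ^ r)⁻¹ * wNorm p γ (iteratedDeriv r (trigRe n z))
  set Ωf := Omega r f (1 / (n : ℝ)) p γ
  set Ωu := Omega r (trigRe n z) (1 / (n : ℝ)) p γ
  constructor
  · calc Ωf ≤ D₁ * a + D₂ * b := h1.trans (add_le_add hΩ h3)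
      _ ≤ (D₁ + D₂) * a + (D₁ + D₂) * b := by
        gcongr
        · exact le_self_add
        · exact le_add_self
      _ = (D₁ + D₂ : ℝ≥0) * (a + b) := by push_cast; ring
      _ ≤ _ := by
        refine mul_le_mul' (ENNReal.coe_le_coe.2 ?_) le_rfl
        rw [add_assoc 1]
        exact le_add_right le_add_self
  · calc a + b ≤ K * (D₄ * Ωf) + D₃ * (D₁ * (K * (D₄ * Ωf)) + Ωf) := by
          refine add_le_add h5 (h4.trans (mul_le_mul_right (h2.trans ?_) _))
          gcongr
          exact hΩ'.trans (mul_le_mul_right h5 _)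
      _ = (K * D₄ + D₃ * (1 + D₁ * (K * D₄)) : ℝ≥0) * Ωf := by push_cast; ring
      _ ≤ _ := by
        exact mul_le_mul' (ENNReal.coe_le_coe.2 le_add_self) le_rfl
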